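/- Let $d\ge 1$, $T>0$, $\sigma\in\mathbb R\setminus\{0\}$. Let $m_0^*:\mathbb R^d\to\mathbb R$ be nonnegative, Hölder continuous, compactly supported, with $\int_{\mathbb R^d} m_0^*\,dx=1$, and let $b:[0,T]\times\mathbb R^d\to\mathbb R^d$ be continuous and bounded, with $|b(t,x)-b(t,y)|\le C_b|x-y|$ for some $C_b>0$ and all $t\in[0,T]$, $x,y\in\mathbb R^d$. *Time steps.* For $N_{\Delta t}\in\mathbb N$, $N_{\Delta t}\ge1$, put $\Delta t=T/N_{\Delta t}$, $t_k=k\Delta t$. Let $e^\ell$, $\ell\in\mathcal I_d=\{1,\dots,3^d\}$, be the values of a random vector $\xi$ in $\mathbb R^d$ with i.i.d. components, $\mathbb P(\xi_i=0)=2/3$, $\mathbb P(\xi_i=\pm\sqrt3)=1/6$, and let $\omega_\ell=\mathbb P(\xi=e^\ell)$. For $\Delta t$ small and $0\le k<N_{\Delta t}$, let $y_k^\ell(x)$ be the unique solution $y$ of $$y=x+\tfrac{\Delta t}{2}\big(b(t_k,x)+b(t_{k+1},y)\big)+\sqrt{\Delta t}\,\sigma e^\ell .$$ Let $L_{\Delta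 t}>0$, $L_{\Delta t}=O(1/\sqrt{\Delta t})$, be such that, for $\Delta t$ small enough, the measures $\mu_k$ defined by $\mu_0=m_0^*\,dx$ and $\int\phi\,d\mu_{k+1}=\sum_\ell\omega_\ell\int\phi(y_k^\ell(x))\,d\mu_k(x)$ ($\phi$ continuous and bounded) are supported in $[-L_{\Delta t},L_{\Delta t}]^d$ for $0\le k\le N_{\Delta t}$. *Space discretization.* Fix $p\in\mathbb N=\{0,1,\dots\}$ and set $q=2p+1$. Let $\widehat\beta:\mathbb R\to\mathbb R$ be the even function which vanishes on $(p+1,\infty)$ and, for $0\le j\le p$, equals $\prod_{k=-p+j,\,k\ne0}^{p+1+j}\frac{\xi-k}{-k}$ on $(j,j+1]$ (on $[0,1]$ if $j=0$). For $N_{\Delta x}\ge1$ put $\Delta x=L_{\Delta t}/N_{\Delta x}$, $\Delta=(\Delta t,\Delta x)$, $\mathcal I_{\Delta x}=\{-N_{\Delta x},\dots,N_{\Delta x}\}^d$, $\beta_i(z)=\prod_{j=1}^d\widehat\beta(z_j/\Delta x-i_j)$ for $i\in\mathcal I_{\Delta x}$, and $\mathcal O_\Delta=[-L_{\Delta t}-(p+1)\Delta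 x,\,L_{\Delta t}+(p+1)\Delta x]^d$, which contains the supports of these $\beta_i$. Let $m_{k,i}$ ($0\le k\le N_{\Delta t}$, $i\in\mathcal I_{\Delta x}$) be the solution of the Lagrange–Galerkin scheme $$\sum_{j}m_{k+1,j}\int_{\mathcal O_\Delta}\beta_i\beta_j\,dx=\sum_{j}m_{k,j}\sum_{\ell}\omega_\ell\int_{\mathcal O_\Delta}\beta_i(y_k^\ell(x))\beta_j(x)\,dx,\qquad \sum_j m_{0,j}\int_{\mathcal O_\Delta}\beta_i\beta_j\,dx=\int_{\mathcal O_\Delta}m_0^*\beta_i\,dx$$ for $i\in\mathcal I_{\Delta x}$, $0\le k<N_{\Delta t}$, with sums over $j\in\mathcal I_{\Delta x}$ and $\ell\in\mathcal I_d$. Put $m_\Delta(t_k,x)=\sum_{i\in\mathcal I_{\Delta x}}m_{k,i}\beta_i(x)$ for $x\in\mathcal O_\Delta$, $m_\Delta(t_k,x)=0$ otherwise, and extend $m_\Delta(\cdot,x)$ to $[0,T]$ by linear interpolation on each $[t_k,t_{k+1}]$. Identify $m_\Delta$ with the map $[0,T]\ni t\mapsto m_\Delta(t,\cdot)\in\mathcal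 D'(\mathbb R^d)$, $\langle m_\Delta(t,\cdot),\phi\rangle=\int_{\mathbb R^d}\phi(x)m_\Delta(t,x)\,dx$ for $\phi\in C_c^\infty(\mathbb R^d)$, where $\mathcal D'(\mathbb R^d)$ carries the weak$^*$ topology and $C([0,T];\mathcal D'(\mathbb R^d))$ the topology of uniform convergence. *Claim.* There exists $\Delta t_0>0$ such that the family $$\{\,m_\Delta \;:\; \Delta t\le\Delta t_0,\ (\Delta x)^{q+1}\le\Delta t\,\}$$ is relatively compact in $C([0,T];\mathcal D'(\mathbb R^d))$. -/

import Mathlib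

open scoped Distributions

namespace LagrangeGalerkin

noncomputable section

/-- `ℝ^d` with its Euclidean norm and Lebesgue measure. -/
abbrev Space (d : ℕ) : Type := EuclideanSpace ℝ (Fin d)

/-- The space of real distributions on `ℝ^d`, i.e. the continuous linear functionals on
`C_c^∞(ℝ^d)`, with the weak-star topology (pointwise convergence on test functions). -/
abbrev DistributionSpace (d : ℕ) : Type :=
  𝓓((⊤ : TopologicalSpace.Opens (Space d)), ℝ) →Lₚₜ[ℝ] ℝ

/-! ### Assumptions on the data of the Fokker-Planck equation -/

/-- The initial density is nonnegative, Hölder continuous, compactly supported, of mass one. -/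
structure InitialDensity {d : ℕ} (m₀ : Space d → ℝ) : Prop where
  nonneg : ∀ x, 0 ≤ m₀ x
  holder : ∃ C r : NNReal, 0 < r ∧ r ≤ 1 ∧ HolderWith C r m₀
  compact_support : HasCompactSupport m₀
  mass_one : ∫ x, m₀ x = 1

/-- The drift is continuous and bounded on `[0,T] × ℝ^d`, and Lipschitz in space uniformly in
time. -/
structure AdmissibleDrift {d : ℕ} (T : ℝ) (b : ℝ → Space d → Space d) : Prop where
  continuous : ContinuousOn (Function.uncurry b) (Set.Icc 0 T ×ˢ Set.univ)
  bounded : ∃ M : ℝ, ∀ t ∈ Set.Icc 0 T, ∀ x, ‖b t x‖ ≤ M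
  lipschitz : ∃ C : ℝ, 0 < C ∧ ∀ t ∈ Set.Icc 0 T, ∀ x y, ‖b t x - b t y‖ ≤ C * ‖x - y‖

/-! ### Time discretization -/

/-- The `3^d` possible values `e^ℓ` of the random vector `ξ`, whose components take the values
`0`, `√3`, `-√3`. -/
def noise {d : ℕ} (l : Fin d → Fin 3) : Space d :=
  WithLp.toLp 2 fun i => (![0, √3, -√3] : Fin 3 → ℝ) (l i)

/-- `ω_ℓ = ℙ(ξ = e^ℓ)`: the components of `ξ` are independent, with probabilities `2/3`, `1/6`,
`1/6` for the values `0`, `√3`, `-√3`. -/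
def weight {d : ℕ} (l : Fin d → Fin 3) : ℝ :=
  ∏ i, (![2 / 3, 1 / 6, 1 / 6] : Fin 3 → ℝ) (l i)

/-- The Crank-Nicolson step `y_k^ℓ(x)`: the solution `y` of
`y = x + (Δt/2) (b(t_k,x) + b(t_{k+1},y)) + √Δt σ e^ℓ`, where `t_k = k Δt`. (It exists and is
unique as soon as `Δt` times the Lipschitz constant of `b` is smaller than `2`.) -/
def cnStep {d : ℕ} (b : ℝ → Space d → Space d) (σ dt : ℝ) (k : ℕ) (l : Fin d → Fin 3)
    (x : Space d) : Space d :=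
  Classical.epsilon fun y : Space d =>
    y = x + (dt / 2) • (b (k * dt) x + b ((k + 1) * dt) y) + (√dt * σ) • noise l

/-- The solution of the scheme that is discrete in time only, as a sequence of measures:
it starts from `m₀ dx`, and `∫ φ dμ_{k+1} = ∑_ℓ ω_ℓ ∫ φ(y_k^ℓ(x)) dμ_k(x)`. -/
def semidiscrete {d : ℕ} (b : ℝ → Space d → Space d) (σ dt : ℝ) (m₀ : Space d → ℝ) :
    ℕ → MeasureTheory.Measure (Space d)
  | 0 => MeasureTheory.volume.withDensity fun x => ENNReal.ofReal (m₀ x)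
  | k + 1 => ∑ l : Fin d → Fin 3,
      ENNReal.ofReal (weight l) • (semidiscrete b σ dt m₀ k).map (cnStep b σ dt k l)

/-- The cube `[-R,R]^d`. -/
def cube (d : ℕ) (R : ℝ) : Set (Space d) := {x | ∀ j, |x j| ≤ R}

/-- `L N`, the value of `L_{Δt}` for `Δt = T/N`, is positive, is `O(1/√Δt)`, and for `Δt` small
enough the semidiscrete solution is supported in `[-L_{Δt}, L_{Δt}]^d` at all times `t_0,…,t_N`. -/
structure AdmissibleHalfWidth {d : ℕ} (T σ : ℝ) (b : ℝ → Space d → Space d) (m₀ : Space d → ℝ)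
    (L : ℕ → ℝ) : Prop where
  pos : ∀ N, 0 < L N
  isBigO : L =O[Filter.atTop] fun N : ℕ => 1 / √(T / N)
  support : ∀ᶠ N : ℕ in Filter.atTop, ∀ k ≤ N,
    (semidiscrete b σ (T / N) m₀ k).support ⊆ cube d (L N)

/-! ### Space discretization -/

/-- The reference basis function of odd order `q = 2p+1`: it is even, vanishes outside
`[-(p+1), p+1]`, and for `ξ ∈ (j, j+1]` (`ξ ∈ [0,1]` if `j = 0`), `0 ≤ j ≤ p`, it is the product
of `(ξ-k)/(-k)` over the integers `k ≠ 0` with `-p+j ≤ k ≤ p+1+j`. -/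
def refBasis (p : ℕ) (ξ : ℝ) : ℝ :=
  if |ξ| ≤ p + 1 then
    ∏ k ∈ (Finset.Icc (-(p : ℤ) + (⌈|ξ|⌉₊ - 1 : ℕ)) (p + 1 + (⌈|ξ|⌉₊ - 1 : ℕ))).erase 0,
      (|ξ| - k) / (-k)
  else 0

/-- `β_i(z) = ∏_j β̂(z_j/Δx - i_j)`. -/
def basis {d : ℕ} (p : ℕ) (dx : ℝ) (i : Fin d → ℤ) (z : Space d) : ℝ :=
  ∏ j, refBasis p (z j / dx - i j)

/-- The index set `{-N,…,N}^d`. -/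
abbrev GridIndex (d N : ℕ) : Type := Fin d → Finset.Icc (-(N : ℤ)) (N : ℤ)

/-- The multi-index in `ℤ^d`. -/
def GridIndex.toInt {d N : ℕ} (i : GridIndex d N) : Fin d → ℤ := fun j => (i j : ℤ)

/-- The cube `𝒪_Δ = [-R,R]^d`, `R = L + (p+1)Δx`, which contains the supports of all `β_i` with
`i ∈ {-N,…,N}^d`, `N Δx = L`. -/
def domain (d p : ℕ) (L dx : ℝ) : Set (Space d) := cube d (L + (p + 1) * dx)

/-- The mass matrix `A_{ij} = ∫_{𝒪_Δ} β_i β_j`. -/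
def massMatrix (d p N : ℕ) (L dx : ℝ) : Matrix (GridIndex d N) (GridIndex d N) ℝ :=
  Matrix.of fun i j =>
    ∫ x in domain d p L dx, basis p dx i.toInt x * basis p dx j.toInt x

/-- The matrix `(B_k^ℓ)_{ij} = ∫_{𝒪_Δ} β_i(y_k^ℓ(x)) β_j(x) dx`. -/
def transportMatrix {d : ℕ} (b : ℝ → Space d → Space d) (σ dt : ℝ) (p N : ℕ) (L dx : ℝ)
    (k : ℕ) (l : Fin d → Fin 3) : Matrix (GridIndex d N) (GridIndex d N) ℝ :=
  Matrix.of fun i j =>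
    ∫ x in domain d p L dx, basis p dx i.toInt (cnStep b σ dt k l x) * basis p dx j.toInt x

/-- The vector with entries `∫_{𝒪_Δ} m₀ β_i`. -/
def initialVector {d : ℕ} (m₀ : Space d → ℝ) (p N : ℕ) (L dx : ℝ) : GridIndex d N → ℝ :=
  fun i => ∫ x in domain d p L dx, m₀ x * basis p dx i.toInt x

/-- The coefficients `m_{k,i}` of the Lagrange-Galerkin scheme: `A m_0` is the initial vector and
`A m_{k+1} = ∑_ℓ ω_ℓ B_k^ℓ m_k`. (The Gram matrix `A` is positive definite, hence invertible.) -/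
def coeff {d : ℕ} (b : ℝ → Space d → Space d) (σ dt : ℝ) (m₀ : Space d → ℝ) (p N : ℕ)
    (L dx : ℝ) : ℕ → GridIndex d N → ℝ
  | 0 => (massMatrix d p N L dx)⁻¹.mulVec (initialVector m₀ p N L dx)
  | k + 1 => (massMatrix d p N L dx)⁻¹.mulVec
      (∑ l : Fin d → Fin 3,
        weight l • (transportMatrix b σ dt p N L dx k l).mulVec (coeff b σ dt m₀ p N L dx k))

/-- `m_Δ(t_k, x) = ∑_i m_{k,i} β_i(x)` for `x ∈ 𝒪_Δ`, and `0` otherwise. -/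
def gridDensity {d : ℕ} (b : ℝ → Space d → Space d) (σ dt : ℝ) (m₀ : Space d → ℝ) (p N : ℕ)
    (L dx : ℝ) (k : ℕ) : Space d → ℝ :=
  (domain d p L dx).indicator fun x =>
    ∑ i : GridIndex d N, coeff b σ dt m₀ p N L dx k i * basis p dx i.toInt x

/-- `m_Δ(t,x)`: the piecewise linear interpolation in time of the values `m_Δ(t_k,x)`,
`0 ≤ k ≤ n`, written with hat functions; see `density_eq`. -/
def density {d : ℕ} (b : ℝ → Space d → Space d) (σ dt : ℝ) (m₀ : Space d → ℝ) (p n N : ℕ)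
    (L dx : ℝ) (t : ℝ) (x : Space d) : ℝ :=
  ∑ k ∈ Finset.range (n + 1), max 0 (1 - |t / dt - k|) * gridDensity b σ dt m₀ p N L dx k x

theorem density_eq {d : ℕ} (b : ℝ → Space d → Space d) (σ dt : ℝ) (hdt : 0 < dt)
    (m₀ : Space d → ℝ) (p n N : ℕ) (L dx : ℝ) (k : ℕ) (hk : k < n) (t : ℝ)
    (h₁ : k * dt ≤ t) (h₂ : t ≤ (k + 1) * dt) (x : Space d) :
    density b σ dt m₀ p n N L dx t x =
      (t - k * dt) / dt * gridDensity b σ dt m₀ p N L dx (k + 1) x +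
        ((k + 1) * dt - t) / dt * gridDensity b σ dt m₀ p N L dx k x := by
  have a₁ : (k : ℝ) ≤ t / dt := (le_div_iff₀ hdt).2 h₁
  have a₂ : t / dt ≤ k + 1 := (div_le_iff₀ hdt).2 h₂
  have e₁ : (t - k * dt) / dt = t / dt - k := by field_simp
  have e₂ : ((k + 1) * dt - t) / dt = k + 1 - t / dt := by field_simp
  rw [e₁, e₂, density]
  generalize t / dt = r at a₁ a₂
  rw [Finset.sum_eq_add_of_mem (k + 1) k (by simp; omega) (by simp; omega) (by omega)]
  · congr 2
    · push_cast
      rw [abs_of_nonpos (by linarith), max_eq_right (by linarith)]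
      ring
    · rw [abs_of_nonneg (by linarith), max_eq_right (by linarith)]
      ring
  · intro c _ hc
    have : max 0 (1 - |r - c|) = 0 := by
      rw [max_eq_left]
      rcases Nat.lt_or_ge c k with h | h
      · have : (c : ℝ) + 1 ≤ k := by exact_mod_cast h
        rw [abs_of_nonneg (by linarith)]
        linarith
      · have h' : k + 2 ≤ c := by omega
        have : (k : ℝ) + 2 ≤ c := by exact_mod_cast h'
        rw [abs_of_nonpos (by linarith)]
        linarith
    rw [this, zero_mul]

/-! ### The discrete density as a continuous curve of distributions -/

theorem isCompact_cube (d : ℕ) (R : ℝ) : IsCompact (cube d R) := by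
  have h : cube d R = (EuclideanSpace.equiv (Fin d) ℝ) ⁻¹' (Set.Icc (fun _ => -R) fun _ => R) := by
    ext x
    simp [cube, Set.mem_Icc, Pi.le_def, abs_le, forall_and]
  rw [h]
  exact (EuclideanSpace.equiv (Fin d) ℝ).toHomeomorph.isCompact_preimage.2 isCompact_Icc

theorem measurable_refBasis (p : ℕ) : Measurable (refBasis p) := by
  let P : ℕ → ℝ → ℝ := fun c ξ =>
    ∏ k ∈ (Finset.Icc (-(p : ℤ) + (c - 1 : ℕ)) (p + 1 + (c - 1 : ℕ))).erase 0, (|ξ| - k) / (-k)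
  have hP : Measurable (Function.uncurry P) :=
    measurable_from_prod_countable_right fun c => by
      change Measurable fun ξ : ℝ => P c ξ
      fun_prop
  have hP' : Measurable fun ξ : ℝ => P ⌈|ξ|⌉₊ ξ :=
    hP.comp ((Nat.measurable_ceil.comp measurable_norm).prodMk measurable_id)
  exact Measurable.ite (measurableSet_le measurable_norm measurable_const) hP' measurable_const

theorem exists_abs_refBasis_le (p : ℕ) : ∃ C, ∀ ξ, |refBasis p ξ| ≤ C := by
  refine ⟨(3 * p + 3 : ℝ) ^ (Finset.Icc (-(p : ℤ)) (2 * p + 1)).card, fun ξ => ?_⟩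
  have hp : (0 : ℝ) ≤ p := Nat.cast_nonneg p
  have h1 : (1 : ℝ) ≤ 3 * p + 3 := by linarith
  rw [refBasis]
  split_ifs with h
  · have hc : ⌈|ξ|⌉₊ ≤ p + 1 := Nat.ceil_le.2 (by exact_mod_cast h)
    rw [Finset.abs_prod]
    calc _ ≤ ∏ _k ∈ (Finset.Icc (-(p : ℤ) + (⌈|ξ|⌉₊ - 1 : ℕ))
              (p + 1 + (⌈|ξ|⌉₊ - 1 : ℕ))).erase 0, (3 * p + 3 : ℝ) := by
          refine Finset.prod_le_prod (fun _ _ => abs_nonneg _) fun k hk => ?_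
          rw [Finset.mem_erase, Finset.mem_Icc] at hk
          obtain ⟨hk0, hk1, hk2⟩ := hk
          have hk3 : |(k : ℝ)| ≤ 2 * p + 1 := by
            have : |k| ≤ 2 * p + 1 := abs_le.2 ⟨by omega, by omega⟩
            exact_mod_cast this
          have hk4 : (1 : ℝ) ≤ |(k : ℝ)| := by
            exact_mod_cast Int.one_le_abs hk0
          rw [abs_div, abs_neg]
          refine (div_le_self (abs_nonneg _) hk4).trans ((abs_sub _ _).trans ?_)
          rw [abs_abs]
          linarith
      _ ≤ _ := by
          rw [Finset.prod_const]
          refine pow_le_pow_right₀ h1 (Finset.card_le_card fun k hk => ?_)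
          rw [Finset.mem_erase, Finset.mem_Icc] at hk
          rw [Finset.mem_Icc]
          omega
  · rw [abs_zero]
    positivity

theorem integrable_gridDensity {d : ℕ} (b : ℝ → Space d → Space d) (σ dt : ℝ)
    (m₀ : Space d → ℝ) (p N : ℕ) (L dx : ℝ) (k : ℕ) :
    MeasureTheory.Integrable (gridDensity b σ dt m₀ p N L dx k) := by
  obtain ⟨C, hC⟩ := exists_abs_refBasis_le p
  have hK : IsCompact (domain d p L dx) := isCompact_cube _ _
  refine (MeasureTheory.integrable_indicator_iff hK.measurableSet).2 ?_
  refine MeasureTheory.integrable_finsetSum _ fun i _ => MeasureTheory.Integrable.const_mul ?_ _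
  refine MeasureTheory.Measure.integrableOn_of_bounded (M := C ^ d) hK.measure_lt_top.ne ?_ ?_
  · refine Measurable.aestronglyMeasurable ?_
    refine Finset.measurable_fun_prod _ fun j _ => (measurable_refBasis p).comp ?_
    fun_prop
  · refine Filter.Eventually.of_forall fun x => ?_
    rw [basis, Real.norm_eq_abs, Finset.abs_prod]
    refine (Finset.prod_le_prod (fun _ _ => abs_nonneg _) fun j _ => hC _).trans ?_
    simp

theorem integrable_density {d : ℕ} (b : ℝ → Space d → Space d) (σ dt : ℝ)
    (m₀ : Space d → ℝ) (p n N : ℕ) (L dx t : ℝ) :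
    MeasureTheory.Integrable (density b σ dt m₀ p n N L dx t) :=
  MeasureTheory.integrable_finsetSum _ fun _ _ => (integrable_gridDensity ..).const_mul _

/-- The regular distribution `φ ↦ ∫ φ(x) f(x) dx` of a locally integrable function `f`. -/
def regular {d : ℕ} (f : Space d → ℝ) : DistributionSpace d :=
  ContinuousLinearMap.toPointwiseConvergenceCLM ℝ (RingHom.id ℝ) _ ℝ
    (TestFunction.integralAgainstBilinCLM (ContinuousLinearMap.mul ℝ ℝ) MeasureTheory.volume f)

theorem regular_apply {d : ℕ} {f : Space d → ℝ} (hf : MeasureTheory.LocallyIntegrable f)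
    (φ : 𝓓((⊤ : TopologicalSpace.Opens (Space d)), ℝ)) : regular f φ = ∫ x, φ x * f x :=
  TestFunction.integralAgainstBilinCLM_eq_integral (hf.locallyIntegrableOn _)

/-- The curve `[0,T] ∋ t ↦ m_Δ(t,·)` in `C([0,T]; 𝒟'(ℝ^d))`, for `Δt = T/n`, `Δx = L/N`. -/
def curve {d : ℕ} (T σ : ℝ) (b : ℝ → Space d → Space d) (m₀ : Space d → ℝ) (p n N : ℕ)
    (L : ℝ) : C(Set.Icc (0 : ℝ) T, DistributionSpace d) where
  toFun t := regular (density b σ (T / n) m₀ p n N L (L / N) t)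
  continuous_toFun := by
    refine PointwiseConvergenceCLM.continuous_of_continuous_eval fun φ => ?_
    have h : ∀ t : Set.Icc (0 : ℝ) T,
        regular (density b σ (T / n) m₀ p n N L (L / N) t) φ =
          ∑ k ∈ Finset.range (n + 1), max 0 (1 - |(t : ℝ) / (T / n) - k|) *
            regular (gridDensity b σ (T / n) m₀ p N L (L / N) k) φ := by
      intro t
      simp only [regular_apply (integrable_density ..).locallyIntegrable,
        regular_apply (integrable_gridDensity ..).locallyIntegrable, density, Finset.mul_sum,
        ← MeasureTheory.integral_const_mul]
      rw [MeasureTheory.integral_finsetSum]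
      · simp only [mul_left_comm]
      · intro k _
        simp only [mul_left_comm]
        exact (TestFunction.integrable_bilin (ContinuousLinearMap.mul ℝ ℝ)
          ((integrable_gridDensity ..).locallyIntegrable.locallyIntegrableOn _) φ).const_mul _
    simp only [h]
    fun_prop

/-- The family of the curves `m_Δ`, `Δ = (Δt, Δx) = (T/n, L_{Δt}/N)`, with `Δt ≤ Δt₀` and
`(Δx)^{q+1} ≤ Δt`, where `q = 2p+1`. -/
def family {d : ℕ} (T σ : ℝ) (b : ℝ → Space d → Space d) (m₀ : Space d → ℝ) (p : ℕ)
    (L : ℕ → ℝ) (dt₀ : ℝ) : Set C(Set.Icc (0 : ℝ) T, DistributionSpace d) :=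
  {f | ∃ n N : ℕ, 0 < n ∧ 0 < N ∧ T / n ≤ dt₀ ∧ (L n / N) ^ (2 * p + 1 + 1) ≤ T / n ∧
    f = curve T σ b m₀ p n N (L n)}

end

end LagrangeGalerkin

open scoped Distributions

namespace LagrangeGalerkin

noncomputable section

open MeasureTheory

/-! By Arzelà–Ascoli, it suffices that the values of all curves lie in one weak-star compact set and
that, against each test function, the curves are uniformly Lipschitz in time.

The first point is an `L²` bound. Testing the scheme with its own solution `m_{k+1}` leaves the `L²`
norm of `m_{k+1} ∘ y_k^ℓ`. The step `y_k^ℓ` is antilipschitz with constant `1 + 2 C Δt`, so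
composition with it costs at most a factor `(1 + 2 C Δt)^d`, and iteration gives `exp (2 C T d)`
(`l2norm_gridDensity_le`). Linear functionals bounded by a fixed multiple of the `L²` norm form a
compact set, by Tychonoff.

For the second, let `ψ` be the interpolant of `φ`. Then `∫ φ (m_{k+1} - m_k)` is the sum of two
interpolation terms, with `φ - ψ` and `(φ - ψ) ∘ y_k^ℓ`, and of `∫ (∑ ω_ℓ φ(y_k^ℓ) - φ) m_k`.
Interpolation is exact on polynomials of degree `q`, so the former are `O(Δx^(q+1)) = O(Δt)`; the
latter is `O(Δt)` because the noise is centred and of size `√Δt` (`exists_abs_increment_le`).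

Interpolation on the truncated grid is accurate only if the grid box contains the support of `φ`.
This holds for small `Δt`, since the support hypothesis forces `L_Δt → ∞`: mass driven by a constant
noise value travels a distance of order `1/√Δt` (`tendsto_halfWidth`). Only finitely many values of
`Δt` remain, and for these the `L²` bound alone controls the increments. -/

/-! ### Compactness in the space of curves of distributions -/

/-- A linear functional on test functions that is bounded by the `L²` norm is continuous. -/
theorem continuous_of_abs_le_sqrt_integral_sq {d : ℕ} {C : ℝ}
    (F : 𝓓((⊤ : TopologicalSpace.Opens (Space d)), ℝ) →ₗ[ℝ] ℝ)
    (hF : ∀ φ, |F φ| ≤ C * √(∫ x, φ x ^ 2)) : Continuous F := by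
  -- In the inductive limit topology, continuity of a linear map is tested on functions supported in
  -- a fixed compact `K`, where the `L²` norm is at most `√(vol K)` times the sup norm.
  rw [TestFunction.continuous_iff_continuous_comp]
  intro K hK
  let G : 𝓓^{⊤}_{K}(Space d, ℝ) →ₗ[ℝ] ℝ :=
    F ∘ₗ (TestFunction.ofSupportedInCLM (n := ⊤) (F := ℝ) ℝ hK).toLinearMap
  change Continuous G
  have hbound : ∀ f : 𝓓^{⊤}_{K}(Space d, ℝ), |G f| ≤ |C| * √(volume.real (K : Set (Space d))) *
      ‖ContDiffMapSupportedIn.toBoundedContinuousFunctionCLM ℝ f‖ := by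
    intro f
    set g := ContDiffMapSupportedIn.toBoundedContinuousFunctionCLM ℝ f with hg
    refine (hF _).trans ?_
    rw [mul_assoc]
    refine (mul_le_mul_of_nonneg_right (le_abs_self C) (Real.sqrt_nonneg _)).trans ?_
    refine mul_le_mul_of_nonneg_left ?_ (abs_nonneg _)
    rw [← Real.sqrt_sq (norm_nonneg g), ← Real.sqrt_mul measureReal_nonneg]
    refine Real.sqrt_le_sqrt ?_
    change ∫ x, (f x) ^ 2 ≤ _
    have h0 : ∀ x, x ∉ (K : Set (Space d)) → f x ^ 2 = 0 := fun x hx => by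
      rw [ContDiffMapSupportedIn.zero_on_compl f hx]
      simp
    rw [← setIntegral_eq_integral_of_forall_compl_eq_zero h0]
    have : ∀ x ∈ (K : Set (Space d)), ‖f x ^ 2‖ ≤ ‖g‖ ^ 2 := by
      intro x _
      rw [norm_pow]
      exact pow_le_pow_left₀ (norm_nonneg _) (g.norm_coe_le_norm x) 2
    have := norm_setIntegral_le_of_norm_le_const (μ := volume) K.isCompact.measure_lt_top this
    rw [mul_comm]
    exact (Real.le_norm_self _).trans this
  refine continuous_of_continuousAt_zero G.toAddMonoidHom ?_
  change Filter.Tendsto G (nhds 0) (nhds (G 0))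
  rw [map_zero]
  refine squeeze_zero_norm hbound ?_
  have : Continuous fun f : 𝓓^{⊤}_{K}(Space d, ℝ) => |C| * √(volume.real (K : Set (Space d))) *
      ‖ContDiffMapSupportedIn.toBoundedContinuousFunctionCLM ℝ f‖ := by fun_prop
  have h0 := this.tendsto 0
  rwa [map_zero, norm_zero, mul_zero] at h0

/-- The distributions bounded by a multiple of the `L²` norm form a weak-star compact set. -/
theorem isCompact_setOf_abs_le_sqrt_integral_sq (d : ℕ) (C : ℝ) :
    IsCompact {F : DistributionSpace d | ∀ φ, |F φ| ≤ C * √(∫ x, φ x ^ 2)} := by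
  set ν : 𝓓((⊤ : TopologicalSpace.Opens (Space d)), ℝ) → ℝ := fun φ => C * √(∫ x, φ x ^ 2)
  -- Inside the product of copies of `ℝ` over all test functions, the set is a Tychonoff box
  -- intersected with the closed set of linear functionals; continuity is automatic by the previous
  -- lemma.
  rw [(PointwiseConvergenceCLM.isEmbedding_coeFn (RingHom.id ℝ)
    𝓓((⊤ : TopologicalSpace.Opens (Space d)), ℝ) ℝ).isCompact_iff]
  have hK : IsCompact (Set.univ.pi fun φ => Set.Icc (-ν φ) (ν φ)) :=
    isCompact_univ_pi fun φ => isCompact_Icc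
  have hcl : IsClosed ({g : 𝓓((⊤ : TopologicalSpace.Opens (Space d)), ℝ) → ℝ |
      (∀ φ ψ, g (φ + ψ) = g φ + g ψ) ∧ ∀ (c : ℝ) φ, g (c • φ) = c * g φ}) := by
    simp only [Set.ofPred_and, Set.ofPred_forall]
    refine IsClosed.inter ?_ ?_
    · exact isClosed_iInter fun φ => isClosed_iInter fun ψ =>
        isClosed_eq (continuous_apply _) ((continuous_apply φ).add (continuous_apply ψ))
    · exact isClosed_iInter fun c => isClosed_iInter fun φ =>
        isClosed_eq (continuous_apply _) ((continuous_apply _).const_mul _)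
  convert hK.inter_right hcl using 1
  ext g
  constructor
  · rintro ⟨F, hF, rfl⟩
    exact ⟨fun φ _ => abs_le.1 (hF φ), fun φ ψ => map_add F φ ψ, fun c φ => map_smul F c φ⟩
  · rintro ⟨h1, h2, h3⟩
    let F : 𝓓((⊤ : TopologicalSpace.Opens (Space d)), ℝ) →ₗ[ℝ] ℝ := ⟨⟨g, h2⟩, h3⟩
    have hF : ∀ φ, |F φ| ≤ ν φ := fun φ => abs_le.2 (h1 φ trivial)
    exact ⟨(⟨F, continuous_of_abs_le_sqrt_integral_sq F hF⟩ :
      𝓓((⊤ : TopologicalSpace.Opens (Space d)), ℝ) →L[ℝ] ℝ), hF, rfl⟩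

/-- Relative compactness of a family of curves of distributions that is bounded in `L²` and, tested
against any test function, Lipschitz in time. -/
theorem isCompact_closure_of_bounded_of_lipschitz {d : ℕ} {T C : ℝ}
    (S : Set C(Set.Icc (0 : ℝ) T, DistributionSpace d))
    (hbound : ∀ f ∈ S, ∀ t φ, |f t φ| ≤ C * √(∫ x, φ x ^ 2))
    (hlip : ∀ φ : 𝓓((⊤ : TopologicalSpace.Opens (Space d)), ℝ), ∃ K : ℝ, ∀ f ∈ S,
      ∀ s t, |f s φ - f t φ| ≤ K * dist s t) :
    IsCompact (closure S) := by
  have hcont : IsClosed {f : UniformOnFun (Set.Icc (0 : ℝ) T) (DistributionSpace d)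
      {K | IsCompact K} | Continuous (UniformOnFun.toFun _ f)} :=
    UniformOnFun.isClosed_setOfPred_continuous
      (Topology.IsCoherentWith.of_nhds fun x => ⟨Set.univ, isCompact_univ, Filter.univ_mem⟩)
  refine ArzelaAscoli.isCompact_closure_of_isClosedEmbedding
    (F := fun f : C(Set.Icc (0 : ℝ) T, DistributionSpace d) => (f : _ → _))
    (𝔖 := {K | IsCompact K}) (fun K hK => hK) ?_ ?_ ?_
  · refine ⟨ContinuousMap.isUniformEmbedding_toUniformOnFunIsCompact.isEmbedding, ?_⟩
    change IsClosed (Set.range ContinuousMap.toUniformOnFunIsCompact)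
    rw [ContinuousMap.range_toUniformOnFunIsCompact]
    exact hcont
  · intro K _
    refine Equicontinuous.equicontinuousOn ?_ K
    -- The weak-star uniformity is induced from a product, so equicontinuity is checked against one
    -- `φ` at a time.
    rw [(PointwiseConvergenceCLM.isUniformEmbedding_coeFn (RingHom.id ℝ)
      𝓓((⊤ : TopologicalSpace.Opens (Space d)), ℝ) ℝ).isUniformInducing.equicontinuous_iff]
    rw [Pi.uniformSpace_eq, equicontinuous_iInf_rng]
    intro φ
    obtain ⟨K, hK⟩ := hlip φ
    refine (@IsUniformInducing.equicontinuous_iff _ _ _ _ _ (UniformSpace.comap (Function.eval φ)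
      inferInstance) inferInstance _ _
      (@IsUniformInducing.mk _ _ (UniformSpace.comap _ _) _ _ rfl)).2 ?_
    refine Metric.equicontinuous_of_continuity_modulus (fun r => K * r) ?_ _ ?_
    · simpa using! (continuous_const_mul K).tendsto 0
    · intro s t f
      exact hK f.1 f.2 s t
  · intro K _ t _
    exact ⟨_, isCompact_setOf_abs_le_sqrt_integral_sq d C, fun f hf => hbound f hf t⟩

/-! ### The reference basis function -/

/-- At `|ξ| = c > 0` the definition uses the piece of the cell to the left; both products contain
the factor `k = c` and vanish, so the formula extends to the closed cell. -/
theorem refBasis_eq_prod {p c : ℕ} (hc : c ≤ p) {ξ : ℝ} (h₁ : c ≤ |ξ|) (h₂ : |ξ| ≤ c + 1) :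
    refBasis p ξ = ∏ k ∈ (Finset.Icc (-(p : ℤ) + c) (p + 1 + c)).erase 0, (|ξ| - k) / (-k) := by
  have hcp : (c : ℝ) ≤ p := by exact_mod_cast hc
  rw [refBasis, if_pos (by linarith)]
  rcases h₁.lt_or_eq with h | h
  · have : ⌈|ξ|⌉₊ = c + 1 := by
      rw [Nat.ceil_eq_iff (by omega)]
      exact ⟨by simpa using h, by exact_mod_cast h₂⟩
    rw [this]
    simp
  · rw [← h, Nat.ceil_natCast]
    rcases Nat.eq_zero_or_pos c with rfl | hpos
    · simp
    · rw [Finset.prod_eq_zero (i := (c : ℤ)), Finset.prod_eq_zero (i := (c : ℤ))]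
      · simp; omega
      · simp
      · simp; omega
      · simp

theorem refBasis_eq_zero {p : ℕ} {ξ : ℝ} (h : (p : ℝ) + 1 ≤ |ξ|) : refBasis p ξ = 0 := by
  rcases h.lt_or_eq with h' | h'
  · rw [refBasis, if_neg (by linarith)]
  · rw [refBasis_eq_prod le_rfl (by linarith) h'.symm.le]
    refine Finset.prod_eq_zero (i := (p : ℤ) + 1) (by simp) ?_
    rw [← h']
    simp

/-- On `[a, a+1]`, the integer translates of the reference basis function are the Lagrange basis
polynomials with nodes `a-p, …, a+p+1`. -/
theorem refBasis_sub_intCast (p : ℕ) (a i : ℤ) {x : ℝ} (h₁ : a ≤ x) (h₂ : x ≤ a + 1) :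
    refBasis p (x - i) = if i ∈ Finset.Icc (a - p) (a + p + 1) then
      ∏ m ∈ (Finset.Icc (a - p) (a + p + 1)).erase i, (x - m) / (i - m) else 0 := by
  split_ifs with hi
  · rw [Finset.mem_Icc] at hi
    -- The number `c` of the cell is counted from the node `i`. If the cell lies to the left of `i`,
    -- evenness turns `x - i` into `i - x` and reflects the nodes.
    rcases le_or_gt i a with hia | hia
    · obtain ⟨c, rfl⟩ : ∃ c : ℕ, a = i + c := ⟨(a - i).toNat, by omega⟩
      push_cast at h₁ h₂
      have hc : (0 : ℝ) ≤ c := Nat.cast_nonneg c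
      have habs : |x - i| = x - i := abs_of_nonneg (by linarith)
      rw [refBasis_eq_prod (c := c) (by omega) (by linarith) (by linarith), habs]
      refine Finset.prod_nbij' (fun k => i + k) (fun m => m - i) ?_ ?_ ?_ ?_ ?_
      · intro k hk; simp at hk ⊢; omega
      · intro k hk; simp at hk ⊢; omega
      · intro k hk; simp
      · intro k hk; simp
      · intro k hk; push_cast; congr 1 <;> ring
    · obtain ⟨c, rfl⟩ : ∃ c : ℕ, a = i - 1 - c := ⟨(i - 1 - a).toNat, by omega⟩
      push_cast at h₁ h₂
      have hc : (0 : ℝ) ≤ c := Nat.cast_nonneg c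
      have habs : |x - i| = i - x := by rw [abs_of_nonpos (by linarith)]; ring
      rw [refBasis_eq_prod (c := c) (by omega) (by linarith) (by linarith), habs]
      refine Finset.prod_nbij' (fun k => i - k) (fun m => i - m) ?_ ?_ ?_ ?_ ?_
      · intro k hk; simp at hk ⊢; omega
      · intro k hk; simp at hk ⊢; omega
      · intro k hk; simp
      · intro k hk; simp
      · intro k hk
        push_cast
        rw [← neg_div_neg_eq]
        congr 1 <;> ring
  · rw [Finset.mem_Icc, not_and_or] at hi
    refine refBasis_eq_zero ?_
    rcases hi with hi | hi
    · have : (i : ℝ) + 1 ≤ a - p := by exact_mod_cast (by omega : i + 1 ≤ a - p)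
      rw [abs_of_nonneg] <;> linarith [(Nat.cast_nonneg p : (0 : ℝ) ≤ p)]
    · have : (a : ℝ) + p + 1 + 1 ≤ i := by exact_mod_cast (by omega : a + p + 1 + 1 ≤ i)
      rw [abs_of_nonpos] <;> linarith [(Nat.cast_nonneg p : (0 : ℝ) ≤ p)]

/-- The function is polynomial on each closed unit cell, and these cells form a locally finite
closed cover. -/
theorem continuous_refBasis (p : ℕ) : Continuous (refBasis p) := by
  have hlf : LocallyFinite fun a : ℤ => Set.Icc (a : ℝ) (a + 1) := by
    intro x
    refine ⟨Set.Ioo (x - 1) (x + 1), Ioo_mem_nhds (by linarith) (by linarith), ?_⟩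
    refine (Set.finite_Icc (⌊x⌋ - 2) (⌊x⌋ + 2)).subset ?_
    rintro a ⟨y, hy, hy'⟩
    rw [Set.mem_Icc] at hy
    rw [Set.mem_Ioo] at hy'
    have h1 := Int.floor_le x
    have h2 := Int.lt_floor_add_one x
    have h3 : (⌊x⌋ : ℝ) - 2 < a := by linarith
    have h4 : (a : ℝ) < ⌊x⌋ + 2 := by linarith
    constructor
    · exact_mod_cast h3.le
    · exact_mod_cast h4.le
  refine hlf.continuous ?_ (fun a => isClosed_Icc) fun a => ?_
  · refine Set.eq_univ_of_forall fun x => Set.mem_iUnion.2 ⟨⌊x⌋, Int.floor_le x,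
      (Int.lt_floor_add_one x).le⟩
  · have h : Set.EqOn (refBasis p) (fun x => if (0 : ℤ) ∈ Finset.Icc (a - p) (a + p + 1) then
        ∏ m ∈ (Finset.Icc (a - p) (a + p + 1)).erase 0, (x - m) / (((0 : ℤ) : ℝ) - m) else 0)
        (Set.Icc (a : ℝ) (a + 1)) := fun x hx => by
      simpa using refBasis_sub_intCast p a 0 hx.1 hx.2
    refine ContinuousOn.congr ?_ h
    split_ifs <;> fun_prop

/-- The nodal property: it makes grid values the coefficients of a Galerkin function, whence the
invertibility of the mass matrix. -/
theorem refBasis_intCast (p : ℕ) (i : ℤ) : refBasis p i = if i = 0 then 1 else 0 := by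
  have := refBasis_sub_intCast p 0 (-i) (x := 0) (by simp) (by simp)
  simp only [Int.cast_neg, sub_neg_eq_add, zero_add] at this
  rw [this]
  by_cases hi : i = 0
  · subst hi
    rw [if_pos (by simp; omega), if_pos rfl]
    refine Finset.prod_eq_one fun m hm => ?_
    have : (m : ℝ) ≠ 0 := by
      have := Finset.ne_of_mem_erase hm
      exact_mod_cast (by simpa using this)
    simp [this]
  · rw [if_neg hi]
    split_ifs with h
    · exact Finset.prod_eq_zero (i := 0) (by simp; omega) (by simp)
    · rfl

open Polynomial in
/-- Lagrange interpolation on `2p+2` nodes reproduces polynomials of degree at most `2p+1`. -/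
theorem sum_eval_mul_refBasis (p : ℕ) (a : ℤ) {x : ℝ} (h₁ : a ≤ x) (h₂ : x ≤ a + 1)
    (P : ℝ[X]) (hP : P.natDegree ≤ 2 * p + 1) :
    ∑ i ∈ Finset.Icc (a - p) (a + p + 1), P.eval (i : ℝ) * refBasis p (x - i) = P.eval x := by
  have hcard : (Finset.Icc (a - p) (a + p + 1)).card = 2 * p + 2 := by
    rw [Int.card_Icc]; omega
  have hdeg : P.degree < (Finset.Icc (a - p) (a + p + 1)).card := by
    rw [hcard]
    exact degree_le_natDegree.trans_lt (by exact_mod_cast (by omega : P.natDegree < 2 * p + 2))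
  have := Lagrange.eq_interpolate (s := Finset.Icc (a - p) (a + p + 1))
    (v := fun i : ℤ => (i : ℝ)) (fun _ _ _ _ h => by simpa using h) hdeg
  conv_rhs => rw [this]
  rw [Lagrange.interpolate_apply, eval_finsetSum]
  refine Finset.sum_congr rfl fun i hi => ?_
  rw [refBasis_sub_intCast p a i h₁ h₂, if_pos hi, eval_mul, eval_C, Lagrange.basis, eval_prod]
  congr 1
  refine Finset.prod_congr rfl fun m hm => ?_
  simp [Lagrange.basisDivisor, div_eq_inv_mul]

/-! ### Interpolation error -/

/-- The Lebesgue function of the reference basis is bounded. -/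
theorem exists_sum_abs_refBasis_le (p : ℕ) :
    ∃ Λ : ℝ, 0 ≤ Λ ∧ ∀ (S : Finset ℤ) (x : ℝ), ∑ i ∈ S, |refBasis p (x - i)| ≤ Λ := by
  obtain ⟨B, hB⟩ := exists_abs_refBasis_le p
  have hB0 : 0 ≤ B := (abs_nonneg _).trans (hB 0)
  refine ⟨(2 * p + 2) * B, by positivity, fun S x => ?_⟩
  set I := Finset.Icc (⌊x⌋ - p) (⌊x⌋ + p + 1)
  have hout : ∀ i ∈ S, i ∉ S ∩ I → |refBasis p (x - i)| = 0 := fun i hi hi' => by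
    rw [refBasis_sub_intCast p ⌊x⌋ i (Int.floor_le x) (Int.lt_floor_add_one x).le, if_neg, abs_zero]
    exact fun h => hi' (Finset.mem_inter.2 ⟨hi, h⟩)
  rw [← Finset.sum_subset Finset.inter_subset_left hout]
  calc ∑ i ∈ S ∩ I, |refBasis p (x - i)| ≤ ∑ i ∈ I, |refBasis p (x - i)| :=
        Finset.sum_le_sum_of_subset_of_nonneg Finset.inter_subset_right fun _ _ _ => abs_nonneg _
    _ ≤ I.card • B := Finset.sum_le_card_nsmul _ _ _ fun i _ => hB _
    _ = (2 * p + 2) * B := by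
        have : I.card = 2 * p + 2 := by rw [Int.card_Icc]; omega
        rw [this, nsmul_eq_mul]; push_cast; ring

theorem abs_sub_taylor_le {g : ℝ → ℝ} {n : ℕ} (hg : ContDiff ℝ (n + 1) g) {M : ℝ}
    (hM : ∀ s, |iteratedDeriv (n + 1) g s| ≤ M) (x y : ℝ) :
    |g y - ∑ k ∈ Finset.range (n + 1), ((k.factorial : ℝ)⁻¹ * iteratedDeriv k g x) * (y - x) ^ k|
      ≤ M * |y - x| ^ (n + 1) := by
  have hM0 : 0 ≤ M := (abs_nonneg _).trans (hM 0)
  rcases eq_or_ne x y with rfl | hxy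
  · have : ∑ k ∈ Finset.range (n + 1),
        ((k.factorial : ℝ)⁻¹ * iteratedDeriv k g x) * (x - x) ^ k = g x := by
      rw [Finset.sum_range_succ']
      simp
    rw [this, sub_self, sub_self]
    simp
  · obtain ⟨x', -, h⟩ := taylor_mean_remainder_lagrange_iteratedDeriv hxy (n := n)
      hg.contDiffOn
    have ht : taylorWithinEval g n (Set.uIcc x y) x y = ∑ k ∈ Finset.range (n + 1),
        ((k.factorial : ℝ)⁻¹ * iteratedDeriv k g x) * (y - x) ^ k := by
      rw [taylor_within_apply]
      refine Finset.sum_congr rfl fun k hk => ?_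
      rw [iteratedDerivWithin_eq_iteratedDeriv (uniqueDiffOn_uIcc hxy) _ Set.left_mem_uIcc]
      · simp only [smul_eq_mul]; ring
      · refine (hg.of_le ?_).contDiffAt
        have : k ≤ n + 1 := (Finset.mem_range.1 hk).le
        exact_mod_cast this
    rw [← ht, h, abs_div, abs_mul, abs_pow, Nat.abs_cast]
    refine (div_le_self (by positivity) ?_).trans ?_
    · exact_mod_cast Nat.one_le_iff_ne_zero.2 (Nat.factorial_ne_zero _)
    · exact mul_le_mul_of_nonneg_right (hM _) (by positivity)

open Polynomial in
/-- One-dimensional interpolation error. -/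
theorem exists_abs_sum_mul_refBasis_sub_le (p : ℕ) : ∃ C : ℝ, 0 ≤ C ∧ ∀ (g : ℝ → ℝ) (M h x : ℝ)
    (S : Finset ℤ), ContDiff ℝ (2 * p + 1 + 1) g → (∀ s, |iteratedDeriv (2 * p + 1 + 1) g s| ≤ M) →
    0 < h → (∀ i : ℤ, i ∉ S → g (i * h) = 0) →
    |∑ i ∈ S, g (i * h) * refBasis p (x / h - i) - g x| ≤ C * M * h ^ (2 * p + 1 + 1) := by
  obtain ⟨Λ, hΛ0, hΛ⟩ := exists_sum_abs_refBasis_le p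
  refine ⟨Λ * (p + 1) ^ (2 * p + 1 + 1), by positivity, fun g M h x S hg hM hh hS => ?_⟩
  have hM0 : 0 ≤ M := (abs_nonneg _).trans (hM 0)
  set ξ := x / h with hξ
  have hxξ : x = h * ξ := by rw [hξ]; field_simp
  set I := Finset.Icc (⌊ξ⌋ - p) (⌊ξ⌋ + p + 1) with hI
  have hout : ∀ i : ℤ, i ∉ I → refBasis p (ξ - i) = 0 := fun i hi => by
    rw [refBasis_sub_intCast p ⌊ξ⌋ i (Int.floor_le ξ) (Int.lt_floor_add_one ξ).le, if_neg hi]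
  -- Off `S` the values of `g` vanish and off `I` the basis does, so `S` may be replaced by the
  -- nodes seen from the cell of `ξ`.
  have hSI : ∑ i ∈ S, g (i * h) * refBasis p (ξ - i) = ∑ i ∈ I, g (i * h) * refBasis p (ξ - i) := by
    refine (Finset.sum_subset (Finset.subset_union_left (s₂ := I)) ?_).trans
      (Finset.sum_subset (Finset.subset_union_right (s₁ := S)) ?_).symm
    · intro i _ hi; rw [hS i hi, zero_mul]
    · intro i _ hi; rw [hout i hi, mul_zero]
  rw [hSI]
  set c : ℕ → ℝ := fun k => (k.factorial : ℝ)⁻¹ * iteratedDeriv k g x with hc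
  -- The Taylor polynomial of `g` at `x`, in the rescaled variable. It is reproduced exactly and
  -- `Q(ξ) = g(x)`, so the error is the sum of `(g(ih) - Q(i)) β̂(ξ - i)`, with `|ih - x| ≤ (p+1)h`.
  set Q : ℝ[X] := ∑ k ∈ Finset.range (2 * p + 1 + 1), C (c k) * (C h * X - C x) ^ k with hQ
  have hQeval : ∀ s : ℝ, Q.eval s =
      ∑ k ∈ Finset.range (2 * p + 1 + 1), c k * (s * h - x) ^ k := fun s => by
    rw [hQ, eval_finsetSum]
    refine Finset.sum_congr rfl fun k _ => ?_
    simp only [eval_mul, eval_C, eval_pow, eval_sub, eval_X, mul_comm h s]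
  have hQdeg : Q.natDegree ≤ 2 * p + 1 := by
    refine natDegree_sum_le_of_forall_le _ _ fun k hk => ?_
    have hk' : k ≤ 2 * p + 1 := by rw [Finset.mem_range] at hk; omega
    refine (natDegree_C_mul_le _ _).trans ((natDegree_pow_le).trans ?_)
    have : (C h * X - C x).natDegree ≤ 1 := by
      rw [natDegree_sub_C]
      exact (natDegree_C_mul_le _ _).trans natDegree_X_le
    exact (Nat.mul_le_mul le_rfl this).trans (by omega)
  have hrep := sum_eval_mul_refBasis p ⌊ξ⌋ (Int.floor_le ξ) (Int.lt_floor_add_one ξ).le Q hQdeg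
  have hQx : Q.eval ξ = g x := by
    rw [hQeval, Finset.sum_range_succ']
    simp [hc, hxξ, mul_comm]
  rw [← hQx, ← hrep, ← Finset.sum_sub_distrib]
  simp only [← sub_mul]
  calc |∑ i ∈ I, (g (i * h) - Q.eval (i : ℝ)) * refBasis p (ξ - i)|
      ≤ ∑ i ∈ I, |(g (i * h) - Q.eval (i : ℝ)) * refBasis p (ξ - i)| :=
        Finset.abs_sum_le_sum_abs _ _
    _ ≤ ∑ i ∈ I, (M * ((p + 1) * h) ^ (2 * p + 1 + 1)) * |refBasis p (ξ - i)| := by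
        refine Finset.sum_le_sum fun i hi => ?_
        rw [abs_mul]
        refine mul_le_mul_of_nonneg_right ?_ (abs_nonneg _)
        rw [hQeval]
        refine (abs_sub_taylor_le (by exact_mod_cast hg) hM x (i * h)).trans ?_
        refine mul_le_mul_of_nonneg_left (pow_le_pow_left₀ (abs_nonneg _) ?_ _) hM0
        rw [hxξ, mul_comm h ξ, ← sub_mul, abs_mul, abs_of_pos hh]
        refine mul_le_mul_of_nonneg_right ?_ hh.le
        rw [hI, Finset.mem_Icc] at hi
        have h1 : (⌊ξ⌋ : ℝ) - p ≤ i := by exact_mod_cast hi.1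
        have h2 : (i : ℝ) ≤ ⌊ξ⌋ + p + 1 := by exact_mod_cast hi.2
        have h3 := Int.floor_le ξ
        have h4 := Int.lt_floor_add_one ξ
        rw [abs_le]
        constructor <;> linarith
    _ ≤ (M * ((p + 1) * h) ^ (2 * p + 1 + 1)) * Λ := by
        rw [← Finset.mul_sum]
        exact mul_le_mul_of_nonneg_left (hΛ I ξ) (by positivity)
    _ = _ := by rw [mul_pow]; ring

/-- Error of a tensor product of one-dimensional linear rules. -/
theorem abs_sum_tensor_sub_le {ι : Type*} [Fintype ι] [Nonempty ι] {Λ ε : ℝ} :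
    ∀ {d : ℕ} (w y : Fin d → ι → ℝ) (x : Fin d → ℝ) (F : (Fin d → ℝ) → ℝ),
    (∀ j, ∑ a, |w j a| ≤ Λ) →
    (∀ j z, |∑ a, F (Function.update z j (y j a)) * w j a - F (Function.update z j (x j))| ≤ ε) →
    |∑ i : Fin d → ι, F (fun j => y j (i j)) * ∏ j, w j (i j) - F x|
      ≤ (∑ j ∈ Finset.range d, Λ ^ j) * ε
  | 0, w, y, x, F, _, _ => by
    have : (fun j => y j ((default : Fin 0 → ι) j)) = x := Subsingleton.elim _ _
    simp [this]
  | d + 1, w, y, x, F, hw, hF => by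
    -- Induction on the dimension: the error of the rule in the last `d` variables is averaged with
    -- the weights `w 0 a`, costing `Λ`, and the error of the first rule is added. This is the
    -- recursion of the geometric sum.
    have ih : ∀ a, |∑ i : Fin d → ι, F (Fin.cons (y 0 a) fun j => y j.succ (i j)) *
        ∏ j, w j.succ (i j) - F (Fin.cons (y 0 a) (Fin.tail x))|
        ≤ (∑ j ∈ Finset.range d, Λ ^ j) * ε := fun a =>
      abs_sum_tensor_sub_le (fun j => w j.succ) (fun j => y j.succ) (Fin.tail x)
        (fun z => F (Fin.cons (y 0 a) z)) (fun j => hw _) fun j z => by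
          simpa only [Fin.cons_update, Fin.tail] using hF j.succ (Fin.cons (y 0 a) z)
    have hsplit : ∑ i : Fin (d + 1) → ι, F (fun j => y j (i j)) * ∏ j, w j (i j) =
        ∑ a, (∑ i : Fin d → ι, F (Fin.cons (y 0 a) fun j => y j.succ (i j)) *
          ∏ j, w j.succ (i j)) * w 0 a := by
      rw [← (Fin.consEquiv fun _ => ι).sum_comp, Fintype.sum_prod_type]
      refine Finset.sum_congr rfl fun a _ => ?_
      rw [Finset.sum_mul]
      refine Finset.sum_congr rfl fun i _ => ?_
      have : (fun j => y j (Fin.cons (α := fun _ => ι) a i j)) =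
          Fin.cons (y 0 a) fun j => y j.succ (i j) := by
        ext j
        refine Fin.cases ?_ (fun j => ?_) j <;> simp
      rw [Fin.prod_univ_succ]
      simp only [Fin.consEquiv_apply, Fin.cons_zero, Fin.cons_succ, this]
      ring
    have h0 := hF 0 (Fin.cons (x 0) (Fin.tail x))
    simp only [Fin.update_cons_zero] at h0
    rw [Fin.cons_self_tail] at h0
    set S := ∑ j ∈ Finset.range d, Λ ^ j
    have key : |∑ a, ((∑ i : Fin d → ι, F (Fin.cons (y 0 a) fun j => y j.succ (i j)) *
        ∏ j, w j.succ (i j)) - F (Fin.cons (y 0 a) (Fin.tail x))) * w 0 a| ≤ Λ * (S * ε) := by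
      refine (Finset.abs_sum_le_sum_abs _ _).trans ?_
      calc _ ≤ ∑ a, (S * ε) * |w 0 a| := by
            refine Finset.sum_le_sum fun a _ => ?_
            rw [abs_mul]
            exact mul_le_mul_of_nonneg_right (ih a) (abs_nonneg _)
        _ ≤ _ := by
            rw [← Finset.mul_sum, mul_comm]
            exact mul_le_mul_of_nonneg_right (hw 0)
              ((abs_nonneg _).trans (ih (Classical.arbitrary ι)))
    rw [hsplit, geom_sum_succ]
    simp only [sub_mul, Finset.sum_sub_distrib] at key
    have := abs_add_le _ _ |>.trans (add_le_add key h0)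
    rw [sub_add_sub_cancel] at this
    refine this.trans (le_of_eq (by ring))

theorem abs_iteratedDeriv_line_le {d n : ℕ} {φ : Space d → ℝ} (hφ : ContDiff ℝ n φ) {M : ℝ}
    (hM : ∀ x, ‖iteratedFDeriv ℝ n φ x‖ ≤ M) (x v : Space d) (hv : ‖v‖ ≤ 1) (s : ℝ) :
    |iteratedDeriv n (fun r : ℝ => φ (x + r • v)) s| ≤ M := by
  let A : ℝ →L[ℝ] Space d := ContinuousLinearMap.toSpanSingleton ℝ v
  have hA : ‖A‖ ≤ 1 := by rwa [ContinuousLinearMap.norm_toSpanSingleton]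
  have hψ : ContDiff ℝ n fun y => φ (x + y) := hφ.comp (contDiff_const.add contDiff_id)
  have h : iteratedFDeriv ℝ n (fun r : ℝ => φ (x + r • v)) s =
      (iteratedFDeriv ℝ n φ (x + A s)).compContinuousLinearMap fun _ => A := by
    rw [← iteratedFDeriv_comp_add_left]
    exact A.iteratedFDeriv_comp_right hψ s le_rfl
  rw [← Real.norm_eq_abs, ← norm_iteratedFDeriv_eq_norm_iteratedDeriv, h]
  refine (ContinuousMultilinearMap.norm_compContinuousLinearMap_le _ _).trans ?_
  rw [Finset.prod_const]
  refine (mul_le_of_le_one_right (norm_nonneg _) (pow_le_one₀ (norm_nonneg _) hA)).trans (hM _)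

theorem toLp_update_eq {d : ℕ} (z : Fin d → ℝ) (j : Fin d) (s : ℝ) :
    (WithLp.toLp 2 (Function.update z j s) : Space d) =
      WithLp.toLp 2 (Function.update z j 0) + s • EuclideanSpace.single j 1 := by
  ext i
  by_cases h : i = j
  · subst h; simp
  · simp [h]

/-- The grid point `Δx i`. -/
def gridPoint {d N : ℕ} (dx : ℝ) (i : GridIndex d N) : Space d :=
  WithLp.toLp 2 fun j => (i.toInt j : ℝ) * dx

/-- The interpolant `∑_i φ(Δx i) β_i`. -/
def interpolant {d : ℕ} (p N : ℕ) (dx : ℝ) (φ : Space d → ℝ) (x : Space d) : ℝ :=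
  ∑ i : GridIndex d N, φ (gridPoint dx i) * basis p dx i.toInt x

instance (N : ℕ) : Nonempty (Finset.Icc (-(N : ℤ)) (N : ℤ)) := ⟨⟨0, by simp⟩⟩

/-- The one-dimensional estimate applies along each coordinate line. The vanishing of `φ` off the
grid box means that the nodes missing from the finite grid would contribute nothing. -/
theorem exists_abs_interpolant_sub_le (d p : ℕ) : ∃ C : ℝ, 0 ≤ C ∧ ∀ (φ : Space d → ℝ) (M : ℝ)
    (N : ℕ) (dx : ℝ), ContDiff ℝ (2 * p + 1 + 1 : ℕ) φ →
    (∀ x, ‖iteratedFDeriv ℝ (2 * p + 1 + 1) φ x‖ ≤ M) → 0 < dx →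
    (∀ x, x ∉ cube d (N * dx) → φ x = 0) →
    ∀ x, |interpolant p N dx φ x - φ x| ≤ C * M * dx ^ (2 * p + 1 + 1) := by
  obtain ⟨Λ, hΛ0, hΛ⟩ := exists_sum_abs_refBasis_le p
  obtain ⟨C, hC0, hC⟩ := exists_abs_sum_mul_refBasis_sub_le p
  refine ⟨(∑ j ∈ Finset.range d, Λ ^ j) * C, by positivity, fun φ M N dx hφ hM hdx hsupp x => ?_⟩
  have := abs_sum_tensor_sub_le (ι := Finset.Icc (-(N : ℤ)) (N : ℤ)) (Λ := Λ)
    (ε := C * M * dx ^ (2 * p + 1 + 1))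
    (fun j a => refBasis p (x j / dx - (a : ℤ))) (fun j a => ((a : ℤ) : ℝ) * dx) x
    (fun z => φ (WithLp.toLp 2 z)) (fun j => ?_) (fun j z => ?_)
  · refine this.trans (le_of_eq (by ring))
  · rw [Finset.sum_coe_sort (Finset.Icc (-(N : ℤ)) (N : ℤ))
      fun a : ℤ => |refBasis p (x j / dx - (a : ℤ))|]
    exact hΛ _ _
  · let g : ℝ → ℝ := fun s => φ (WithLp.toLp 2 (Function.update z j s))
    have hg : g = fun s : ℝ => φ (WithLp.toLp 2 (Function.update z j 0) +
        s • EuclideanSpace.single j 1) := by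
      ext s
      exact congrArg φ (toLp_update_eq z j s)
    rw [Finset.sum_coe_sort (Finset.Icc (-(N : ℤ)) (N : ℤ))
      fun a : ℤ => g (a * dx) * refBasis p (x j / dx - (a : ℤ))]
    refine hC g M dx (x j) _ ?_ ?_ hdx ?_
    · rw [hg]
      refine ContDiff.comp (by exact_mod_cast hφ) ?_
      exact contDiff_const.add (contDiff_id.smul contDiff_const)
    · intro s
      rw [hg]
      exact abs_iteratedDeriv_line_le hφ hM _ _ (by simp) s
    · intro i hi
      refine hsupp _ fun hmem => hi ?_
      have := hmem j
      simp only [Function.update_self, abs_mul, abs_of_pos hdx] at this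
      have h1 : |(i : ℝ)| ≤ N := le_of_mul_le_mul_right this hdx
      have h2 : |i| ≤ N := by exact_mod_cast h1
      rw [Finset.mem_Icc]
      exact abs_le.1 h2

/-! ### The basis functions -/

theorem continuous_basis {d : ℕ} (p : ℕ) (dx : ℝ) (i : Fin d → ℤ) :
    Continuous (basis p dx i) := by
  refine continuous_finsetProd _ fun j _ => (continuous_refBasis p).comp ?_
  fun_prop

theorem basis_eq_zero {d p : ℕ} {dx R : ℝ} (hdx : 0 < dx) {i : Fin d → ℤ}
    (hi : ∀ j, |(i j : ℝ) * dx| ≤ R) {x : Space d} (hx : x ∉ cube d (R + (p + 1) * dx)) :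
    basis p dx i x = 0 := by
  obtain ⟨j, hj⟩ : ∃ j, R + (p + 1) * dx < |x j| := by simpa [cube] using hx
  refine Finset.prod_eq_zero (Finset.mem_univ j) (refBasis_eq_zero ?_)
  have h1 : |x j| ≤ |x j / dx - i j| * dx + R := by
    calc |x j| = |(x j / dx - i j) * dx + i j * dx| := by congr 1; field_simp; ring
      _ ≤ |(x j / dx - i j) * dx| + |i j * dx| := abs_add_le _ _
      _ ≤ _ := by rw [abs_mul _ dx, abs_of_pos hdx]; linarith [hi j]
  have h2 : (p + 1) * dx < |x j / dx - i j| * dx := by linarith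
  exact (lt_of_mul_lt_mul_right h2 hdx.le).le

theorem abs_toInt_mul_le {d N : ℕ} (i : GridIndex d N) {dx : ℝ} (hdx : 0 < dx) (j : Fin d) :
    |(i.toInt j : ℝ) * dx| ≤ N * dx := by
  rw [abs_mul, abs_of_pos hdx]
  refine mul_le_mul_of_nonneg_right ?_ hdx.le
  have h : |i.toInt j| ≤ N := abs_le.2 (Finset.mem_Icc.1 (i j).2)
  exact_mod_cast h

theorem basis_eq_zero_of_notMem_domain {d p N : ℕ} {L dx : ℝ} (hdx : 0 < dx) (hL : N * dx = L)
    (i : GridIndex d N) {x : Space d} (hx : x ∉ domain d p L dx) : basis p dx i.toInt x = 0 := by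
  refine basis_eq_zero hdx (fun j => ?_) hx
  exact hL ▸ abs_toInt_mul_le i hdx j

/-- This confines the interpolation error to a cube depending on `φ` and not on `L`, so its `L²`
norm stays controlled as the domain grows. -/
theorem interpolant_eq_zero {d p N : ℕ} {dx R : ℝ} (hdx : 0 < dx) {φ : Space d → ℝ}
    (hφ : ∀ x, x ∉ cube d R → φ x = 0) {x : Space d} (hx : x ∉ cube d (R + (p + 1) * dx)) :
    interpolant p N dx φ x = 0 := by
  refine Finset.sum_eq_zero fun i _ => ?_
  by_cases h : gridPoint dx i ∈ cube d R
  · rw [basis_eq_zero hdx h hx, mul_zero]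
  · rw [hφ _ h, zero_mul]

theorem hasCompactSupport_basis {d p N : ℕ} {L dx : ℝ} (hdx : 0 < dx) (hL : N * dx = L)
    (i : GridIndex d N) : HasCompactSupport (basis p dx i.toInt) :=
  HasCompactSupport.intro (isCompact_cube d _) fun _ hx =>
    basis_eq_zero_of_notMem_domain hdx hL i hx

theorem basis_gridPoint {d p N : ℕ} {dx : ℝ} (hdx : 0 < dx) (i j : GridIndex d N) :
    basis p dx i.toInt (gridPoint dx j) = if i = j then 1 else 0 := by
  have h : ∀ s, (gridPoint dx j) s / dx - i.toInt s = ((j.toInt s - i.toInt s : ℤ) : ℝ) := by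
    intro s
    simp only [gridPoint]
    push_cast
    field_simp
  simp only [basis, h, refBasis_intCast]
  split_ifs with hij
  · subst hij; simp
  · obtain ⟨s, hs⟩ := Function.ne_iff.1 hij
    refine Finset.prod_eq_zero (Finset.mem_univ s) (if_neg fun h0 => hs ?_)
    exact Subtype.ext (by simp only [GridIndex.toInt] at h0; omega)

/-! ### The Galerkin space and the weak form of the scheme -/

/-- The element `∑_i v_i β_i` of the Galerkin space. -/
def galerkin {d : ℕ} (p N : ℕ) (dx : ℝ) (v : GridIndex d N → ℝ) (x : Space d) : ℝ :=
  ∑ i : GridIndex d N, v i * basis p dx i.toInt x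

section Galerkin

variable {d p N : ℕ} {L dx : ℝ}

theorem continuous_galerkin (v : GridIndex d N → ℝ) : Continuous (galerkin p N dx v) :=
  continuous_finsetSum _ fun i _ => (continuous_basis p dx i.toInt).const_mul _

theorem galerkin_eq_zero (hdx : 0 < dx) (hL : N * dx = L) (v : GridIndex d N → ℝ) {x : Space d}
    (hx : x ∉ domain d p L dx) : galerkin p N dx v x = 0 :=
  Finset.sum_eq_zero fun i _ => by
    rw [basis_eq_zero_of_notMem_domain hdx hL i hx, mul_zero]

theorem hasCompactSupport_galerkin (hdx : 0 < dx) (v : GridIndex d N → ℝ) :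
    HasCompactSupport (galerkin p N dx v) :=
  HasCompactSupport.intro (isCompact_cube d _) fun _ hx => galerkin_eq_zero hdx rfl v hx

theorem galerkin_gridPoint (hdx : 0 < dx) (v : GridIndex d N → ℝ) (j : GridIndex d N) :
    galerkin p N dx v (gridPoint dx j) = v j := by
  simp [galerkin, basis_gridPoint hdx]

theorem massMatrix_mulVec (hdx : 0 < dx) (hL : N * dx = L) (v : GridIndex d N → ℝ)
    (i : GridIndex d N) :
    (massMatrix d p N L dx).mulVec v i = ∫ x, basis p dx i.toInt x * galerkin p N dx v x := by
  simp only [Matrix.mulVec, dotProduct, massMatrix, Matrix.of_apply, galerkin, Finset.mul_sum]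
  rw [integral_finsetSum]
  · refine Finset.sum_congr rfl fun j _ => ?_
    rw [setIntegral_eq_integral_of_forall_compl_eq_zero fun x hx => by
      rw [basis_eq_zero_of_notMem_domain hdx hL i hx, zero_mul], ← integral_mul_const]
    congr 1
    ext x
    ring
  · intro j _
    refine Continuous.integrable_of_hasCompactSupport ?_ ?_
    · exact (continuous_basis ..).mul ((continuous_basis ..).const_mul _)
    · exact (hasCompactSupport_basis hdx hL i).mul_right

theorem sum_mul_massMatrix_mulVec (hdx : 0 < dx) (hL : N * dx = L) (w v : GridIndex d N → ℝ) :
    ∑ i, w i * (massMatrix d p N L dx).mulVec v i =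
      ∫ x, galerkin p N dx w x * galerkin p N dx v x := by
  simp only [massMatrix_mulVec hdx hL, ← integral_const_mul]
  rw [← integral_finsetSum]
  · congr 1
    ext x
    change _ = (∑ i, w i * basis p dx i.toInt x) * _
    rw [Finset.sum_mul]
    exact Finset.sum_congr rfl fun i _ => by ring
  · intro i _
    refine Continuous.integrable_of_hasCompactSupport ?_ ?_
    · exact ((continuous_basis ..).mul (continuous_galerkin v)).const_mul _
    · exact HasCompactSupport.mul_left (hasCompactSupport_basis hdx hL i).mul_right

/-- A Gram matrix: a kernel vector gives a Galerkin function of zero `L²` norm, which vanishes by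
continuity, and so do its nodal values. -/
theorem isUnit_massMatrix (hdx : 0 < dx) (hL : N * dx = L) : IsUnit (massMatrix d p N L dx) := by
  rw [← Matrix.mulVec_injective_iff_isUnit]
  refine (injective_iff_map_eq_zero (massMatrix d p N L dx).mulVecLin).2 fun v hv => ?_
  rw [Matrix.mulVecLin_apply] at hv
  have h : ∫ x, galerkin p N dx v x * galerkin p N dx v x = 0 := by
    rw [← sum_mul_massMatrix_mulVec hdx hL, hv]
    simp
  have hc : Continuous fun x => galerkin p N dx v x * galerkin p N dx v x :=
    (continuous_galerkin v).mul (continuous_galerkin v)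
  rw [integral_eq_zero_iff_of_nonneg (fun x => mul_self_nonneg _)
    (hc.integrable_of_hasCompactSupport (hasCompactSupport_galerkin hdx v).mul_right),
    hc.ae_eq_iff_eq volume continuous_zero] at h
  ext j
  have := congrFun h (gridPoint dx j)
  rw [galerkin_gridPoint hdx] at this
  simpa using this

theorem massMatrix_mulVec_inv_mulVec (hdx : 0 < dx) (hL : N * dx = L) (v : GridIndex d N → ℝ) :
    (massMatrix d p N L dx).mulVec ((massMatrix d p N L dx)⁻¹.mulVec v) = v := by
  rw [Matrix.mulVec_mulVec, Matrix.mul_nonsing_inv _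
    ((Matrix.isUnit_iff_isUnit_det _).1 (isUnit_massMatrix hdx hL)), Matrix.one_mulVec]

theorem gridDensity_eq_galerkin (hdx : 0 < dx) (hL : N * dx = L) (b : ℝ → Space d → Space d)
    (σ dt : ℝ) (m₀ : Space d → ℝ) (k : ℕ) :
    gridDensity b σ dt m₀ p N L dx k = galerkin p N dx (coeff b σ dt m₀ p N L dx k) := by
  ext x
  by_cases hx : x ∈ domain d p L dx
  · exact Set.indicator_of_mem hx _
  · rw [galerkin_eq_zero hdx hL _ hx]
    exact Set.indicator_of_notMem hx _

/-- The initial density is the `L²` projection of `m₀` onto the Galerkin space. -/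
theorem integral_galerkin_mul_gridDensity_zero (hdx : 0 < dx) (hL : N * dx = L)
    (b : ℝ → Space d → Space d) (σ dt : ℝ) {m₀ : Space d → ℝ} (hm₀ : Continuous m₀)
    (w : GridIndex d N → ℝ) :
    ∫ x, galerkin p N dx w x * gridDensity b σ dt m₀ p N L dx 0 x =
      ∫ x, galerkin p N dx w x * m₀ x := by
  rw [gridDensity_eq_galerkin hdx hL, ← sum_mul_massMatrix_mulVec hdx hL, coeff,
    massMatrix_mulVec_inv_mulVec hdx hL]
  simp only [initialVector, ← integral_const_mul]
  have h : ∀ i : GridIndex d N, ∫ x in domain d p L dx, w i * (m₀ x * basis p dx i.toInt x) =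
      ∫ x, w i * (m₀ x * basis p dx i.toInt x) := fun i =>
    setIntegral_eq_integral_of_forall_compl_eq_zero fun x hx => by
      rw [basis_eq_zero_of_notMem_domain hdx hL i hx, mul_zero, mul_zero]
  simp only [h]
  rw [← integral_finsetSum]
  · congr 1
    ext x
    change _ = (∑ i, w i * basis p dx i.toInt x) * _
    rw [Finset.sum_mul]
    exact Finset.sum_congr rfl fun i _ => by ring
  · intro i _
    refine Continuous.integrable_of_hasCompactSupport ?_ ?_
    · exact (hm₀.mul (continuous_basis ..)).const_mul _
    · exact HasCompactSupport.mul_left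
        (HasCompactSupport.mul_left (hasCompactSupport_basis hdx hL i))

/-- The weak form of one step. It is tested with `m_{k+1}` for stability and with an interpolant for
the increments. Integrals extend from `𝒪_Δ` to the whole space because the untransported factor
vanishes outside. -/
theorem integral_galerkin_mul_gridDensity_succ (hdx : 0 < dx) (hL : N * dx = L)
    {b : ℝ → Space d → Space d} {σ dt : ℝ} (m₀ : Space d → ℝ) {k : ℕ}
    (hy : ∀ l, Continuous (cnStep b σ dt k l)) (w : GridIndex d N → ℝ) :
    ∫ x, galerkin p N dx w x * gridDensity b σ dt m₀ p N L dx (k + 1) x =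
      ∑ l, weight l * ∫ x, galerkin p N dx w (cnStep b σ dt k l x) *
        gridDensity b σ dt m₀ p N L dx k x := by
  rw [gridDensity_eq_galerkin hdx hL, gridDensity_eq_galerkin hdx hL,
    ← sum_mul_massMatrix_mulVec hdx hL, coeff, massMatrix_mulVec_inv_mulVec hdx hL]
  set c := coeff b σ dt m₀ p N L dx k
  have hintegrable : ∀ (l : Fin d → Fin 3) (i j : GridIndex d N), Integrable fun x =>
      w i * basis p dx i.toInt (cnStep b σ dt k l x) * (c j * basis p dx j.toInt x) := by
    intro l i j
    refine Continuous.integrable_of_hasCompactSupport ?_ ?_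
    · exact (((continuous_basis ..).comp (hy l)).const_mul _).mul
        ((continuous_basis ..).const_mul _)
    · exact HasCompactSupport.mul_left
        (HasCompactSupport.mul_left (hasCompactSupport_basis hdx hL j))
  have hset : ∀ (l : Fin d → Fin 3) (i j : GridIndex d N),
      w i * (transportMatrix b σ dt p N L dx k l i j * c j) =
      ∫ x, w i * basis p dx i.toInt (cnStep b σ dt k l x) * (c j * basis p dx j.toInt x) := by
    intro l i j
    rw [transportMatrix, Matrix.of_apply, setIntegral_eq_integral_of_forall_compl_eq_zero
      fun x hx => by rw [basis_eq_zero_of_notMem_domain hdx hL j hx, mul_zero],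
      ← integral_mul_const, ← integral_const_mul]
    congr 1
    ext x
    ring
  have hrhs : ∀ l, ∫ x, galerkin p N dx w (cnStep b σ dt k l x) * galerkin p N dx c x =
      ∑ i, ∑ j, w i * (transportMatrix b σ dt p N L dx k l i j * c j) := by
    intro l
    simp only [hset, galerkin, Finset.sum_mul_sum]
    rw [integral_finsetSum _ fun i _ =>
      integrable_finsetSum _ fun j _ => hintegrable l i j]
    exact Finset.sum_congr rfl fun i _ => integral_finsetSum _ fun j _ => hintegrable l i j
  simp only [hrhs, Finset.sum_apply, Pi.smul_apply, smul_eq_mul, Matrix.mulVec, dotProduct,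
    Finset.mul_sum]
  rw [Finset.sum_comm]
  exact Finset.sum_congr rfl fun l _ => Finset.sum_congr rfl fun i _ =>
    Finset.sum_congr rfl fun j _ => by ring

end Galerkin

/-! ### The Crank-Nicolson step -/

section CrankNicolson

variable {d : ℕ} {b : ℝ → Space d → Space d} {σ dt T C M : ℝ} {k : ℕ}

/-- The implicit equation is a fixed-point problem for a contraction of constant `C Δt / 2 ≤ 1/2`,
so `epsilon` selects a genuine solution. -/
theorem cnStep_spec (hdt : 0 < dt) (hCdt : C * dt ≤ 1)
    (hlip : ∀ x y, ‖b ((k + 1) * dt) x - b ((k + 1) * dt) y‖ ≤ C * ‖x - y‖)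
    (l : Fin d → Fin 3) (x : Space d) :
    cnStep b σ dt k l x = x + (dt / 2) • (b (k * dt) x + b ((k + 1) * dt) (cnStep b σ dt k l x)) +
      (√dt * σ) • noise l := by
  refine Classical.epsilon_spec (p := fun y : Space d => y = x + (dt / 2) • (b (k * dt) x +
    b ((k + 1) * dt) y) + (√dt * σ) • noise l) ?_
  let F : Space d → Space d := fun y => x + (dt / 2) • (b (k * dt) x +
    b ((k + 1) * dt) y) + (√dt * σ) • noise l
  have hF : ContractingWith (1 / 2) F := by
    refine ⟨by rw [← NNReal.coe_lt_coe]; norm_num, LipschitzWith.of_dist_le_mul fun y z => ?_⟩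
    have h : F y - F z = (dt / 2) • (b ((k + 1) * dt) y - b ((k + 1) * dt) z) := by
      simp only [F, smul_sub, smul_add]; abel
    rw [dist_eq_norm, dist_eq_norm, h, norm_smul, Real.norm_of_nonneg (by positivity)]
    have := mul_le_mul_of_nonneg_left (hlip y z) (by positivity : 0 ≤ dt / 2)
    refine this.trans ?_
    rw [← mul_assoc]
    refine mul_le_mul_of_nonneg_right ?_ (norm_nonneg _)
    push_cast
    linarith
  exact ⟨hF.fixedPoint F, (hF.fixedPoint_isFixedPt (f := F)).symm⟩

/-- The noise is additive and cancels in the difference, leaving only drift increments. -/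
theorem norm_cnStep_sub_le (hdt : 0 < dt) (hCdt : C * dt ≤ 1)
    (hlip₀ : ∀ x y, ‖b (k * dt) x - b (k * dt) y‖ ≤ C * ‖x - y‖)
    (hlip : ∀ x y, ‖b ((k + 1) * dt) x - b ((k + 1) * dt) y‖ ≤ C * ‖x - y‖)
    (l : Fin d → Fin 3) (x x' : Space d) :
    ‖(cnStep b σ dt k l x - cnStep b σ dt k l x') - (x - x')‖ ≤
      C * dt / 2 * (‖x - x'‖ + ‖cnStep b σ dt k l x - cnStep b σ dt k l x'‖) := by
  have h := cnStep_spec (σ := σ) hdt hCdt hlip l x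
  have h' := cnStep_spec (σ := σ) hdt hCdt hlip l x'
  set y := cnStep b σ dt k l x
  set y' := cnStep b σ dt k l x'
  have e : (y - y') - (x - x') = (dt / 2) • ((b (k * dt) x - b (k * dt) x') +
      (b ((k + 1) * dt) y - b ((k + 1) * dt) y')) := by
    calc (y - y') - (x - x') = (x + (dt / 2) • (b (k * dt) x + b ((k + 1) * dt) y) +
          (√dt * σ) • noise l - (x' + (dt / 2) • (b (k * dt) x' + b ((k + 1) * dt) y') +
          (√dt * σ) • noise l)) - (x - x') := by rw [← h, ← h']
      _ = _ := by simp only [smul_sub, smul_add]; abel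
  rw [e, norm_smul, Real.norm_of_nonneg (by positivity)]
  have := (norm_add_le _ _).trans (add_le_add (hlip₀ x x') (hlip y y'))
  calc _ ≤ dt / 2 * _ := mul_le_mul_of_nonneg_left this (by positivity)
    _ = _ := by ring

theorem antilipschitzWith_cnStep (hC : 0 < C) (hdt : 0 < dt) (hCdt : C * dt ≤ 1)
    (hlip₀ : ∀ x y, ‖b (k * dt) x - b (k * dt) y‖ ≤ C * ‖x - y‖)
    (hlip : ∀ x y, ‖b ((k + 1) * dt) x - b ((k + 1) * dt) y‖ ≤ C * ‖x - y‖)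
    (l : Fin d → Fin 3) :
    AntilipschitzWith (1 + 2 * (C * dt)).toNNReal (cnStep b σ dt k l) := by
  refine AntilipschitzWith.of_le_mul_dist fun x x' => ?_
  have h := norm_cnStep_sub_le (σ := σ) hdt hCdt hlip₀ hlip l x x'
  have hc : 0 < C * dt := by positivity
  rw [Real.coe_toNNReal _ (by positivity), dist_eq_norm, dist_eq_norm]
  have h2 := norm_sub_norm_le (x - x') (cnStep b σ dt k l x - cnStep b σ dt k l x')
  rw [norm_sub_rev (x - x')] at h2
  set u := ‖x - x'‖
  set v := ‖cnStep b σ dt k l x - cnStep b σ dt k l x'‖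
  have hu : 0 ≤ u := norm_nonneg _
  have hv : 0 ≤ v := norm_nonneg _
  set c := C * dt
  have h3 : (1 - c / 2) * u ≤ (1 + c / 2) * v := by linarith
  -- For `v > 0` this amounts to `c² ≤ c`, i.e. to `C Δt ≤ 1`.
  have h4 : (1 + c / 2) * v ≤ (1 - c / 2) * ((1 + 2 * c) * v) := by nlinarith [mul_nonneg hc.le hv]
  exact le_of_mul_le_mul_left (h3.trans h4) (by linarith)

theorem continuous_cnStep (hdt : 0 < dt) (hCdt : C * dt ≤ 1)
    (hlip₀ : ∀ x y, ‖b (k * dt) x - b (k * dt) y‖ ≤ C * ‖x - y‖)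
    (hlip : ∀ x y, ‖b ((k + 1) * dt) x - b ((k + 1) * dt) y‖ ≤ C * ‖x - y‖)
    (l : Fin d → Fin 3) : Continuous (cnStep b σ dt k l) := by
  -- With `c = C Δt ≤ 1`, the estimate `(1 - c/2) v ≤ (1 + c/2) u` gives the ratio `(3/2)/(1/2) =
  -- 3`.
  refine (LipschitzWith.of_dist_le_mul (K := 3) fun x x' => ?_).continuous
  have h := norm_cnStep_sub_le (σ := σ) hdt hCdt hlip₀ hlip l x x'
  rw [dist_eq_norm, dist_eq_norm]
  have h2 := norm_sub_norm_le (cnStep b σ dt k l x - cnStep b σ dt k l x') (x - x')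
  set u := ‖x - x'‖
  set v := ‖cnStep b σ dt k l x - cnStep b σ dt k l x'‖
  have hu : 0 ≤ u := norm_nonneg _
  have hv : 0 ≤ v := norm_nonneg _
  push_cast
  nlinarith

theorem norm_cnStep_sub_sub_le (hdt : 0 < dt) (hCdt : C * dt ≤ 1)
    (hlip : ∀ x y, ‖b ((k + 1) * dt) x - b ((k + 1) * dt) y‖ ≤ C * ‖x - y‖)
    (hM₀ : ∀ x, ‖b (k * dt) x‖ ≤ M) (hM : ∀ x, ‖b ((k + 1) * dt) x‖ ≤ M)
    (l : Fin d → Fin 3) (x : Space d) :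
    ‖cnStep b σ dt k l x - x - (√dt * σ) • noise l‖ ≤ M * dt := by
  have h := cnStep_spec (σ := σ) hdt hCdt hlip l x
  set y := cnStep b σ dt k l x
  have e : y - x - (√dt * σ) • noise l = (dt / 2) • (b (k * dt) x + b ((k + 1) * dt) y) := by
    calc _ = x + (dt / 2) • (b (k * dt) x + b ((k + 1) * dt) y) + (√dt * σ) • noise l - x -
          (√dt * σ) • noise l := by rw [← h]
      _ = _ := by abel
  rw [e, norm_smul, Real.norm_of_nonneg (by positivity)]
  have := (norm_add_le _ _).trans (add_le_add (hM₀ x) (hM y))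
  calc _ ≤ dt / 2 * _ := mul_le_mul_of_nonneg_left this (by positivity)
    _ = _ := by ring

end CrankNicolson

/-! ### Change of variables -/

/-- Lebesgue measure is a multiple of the `d`-dimensional Hausdorff measure, which scales by `K ^ d`
under antilipschitz preimages. No Jacobian enters, as the drift is merely Lipschitz. -/
theorem volume_preimage_le_of_antilipschitzWith {d : ℕ} {K : NNReal} {f : Space d → Space d}
    (hf : AntilipschitzWith K f) (s : Set (Space d)) :
    volume (f ⁻¹' s) ≤ (K : ENNReal) ^ d * volume s := by
  have hc := Measure.isAddLeftInvariant_eq_smul (volume : Measure (Space d))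
    (Measure.hausdorffMeasure (d : ℝ))
  have h := hf.hausdorffMeasure_preimage_le (Nat.cast_nonneg d) s
  rw [hc, Measure.smul_apply, Measure.smul_apply, ENNReal.smul_def, ENNReal.smul_def, smul_eq_mul,
    smul_eq_mul, mul_left_comm]
  gcongr
  simpa using h

theorem map_volume_le_of_antilipschitzWith {d : ℕ} {K : NNReal} {f : Space d → Space d}
    (hf : AntilipschitzWith K f) (hfc : Continuous f) :
    (volume : Measure (Space d)).map f ≤ (K ^ d : NNReal) • volume := by
  refine Measure.le_iff.2 fun s hs => ?_
  rw [Measure.map_apply hfc.measurable hs]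
  exact (volume_preimage_le_of_antilipschitzWith hf s).trans (by simp [ENNReal.smul_def])

theorem integrable_comp_of_antilipschitzWith {d : ℕ} {K : NNReal} {f : Space d → Space d}
    (hf : AntilipschitzWith K f) (hfc : Continuous f) {g : Space d → ℝ} (hg : Integrable g) :
    Integrable fun x => g (f x) := by
  have h : Integrable g (Measure.map f volume) :=
    (hg.smul_measure_nnreal (c := K ^ d)).mono_measure (map_volume_le_of_antilipschitzWith hf hfc)
  exact h.comp_measurable hfc.measurable

theorem integral_comp_le_of_antilipschitzWith {d : ℕ} {K : NNReal} {f : Space d → Space d}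
    (hf : AntilipschitzWith K f) (hfc : Continuous f) {g : Space d → ℝ} (hg : Integrable g)
    (hg0 : ∀ x, 0 ≤ g x) : ∫ x, g (f x) ≤ K ^ d * ∫ x, g x := by
  have hle := map_volume_le_of_antilipschitzWith hf hfc
  have hi : Integrable g ((K ^ d : NNReal) • (volume : Measure (Space d))) :=
    hg.smul_measure_nnreal
  rw [← integral_map hfc.aemeasurable (hi.mono_measure hle).aestronglyMeasurable]
  refine (integral_mono_measure hle (Filter.Eventually.of_forall hg0) hi).trans ?_
  rw [integral_smul_nnreal_measure]
  simp [NNReal.smul_def]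

/-! ### The discrete noise -/

theorem weight_pos {d : ℕ} (l : Fin d → Fin 3) : 0 < weight l := by
  refine Finset.prod_pos fun i _ => ?_
  generalize l i = a
  fin_cases a <;> norm_num

theorem weight_nonneg {d : ℕ} (l : Fin d → Fin 3) : 0 ≤ weight l := (weight_pos l).le

theorem sum_weight (d : ℕ) : ∑ l : Fin d → Fin 3, weight l = 1 := by
  have h := Finset.prod_univ_sum (fun _ : Fin d => (Finset.univ : Finset (Fin 3)))
    fun _ a => (![2 / 3, 1 / 6, 1 / 6] : Fin 3 → ℝ) a
  rw [Fintype.piFinset_univ] at h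
  simp only [weight]
  rw [← h]
  refine Finset.prod_eq_one fun _ _ => ?_
  simp [Fin.sum_univ_three]
  norm_num

/-- Exchanging `√3` and `-√3` preserves the weights and changes the sign of the noise. This first
moment is the only one whose exact value matters; beyond it, boundedness of the noise suffices. -/
theorem sum_weight_smul_noise (d : ℕ) : ∑ l : Fin d → Fin 3, weight l • noise l = 0 := by
  let e : (Fin d → Fin 3) ≃ (Fin d → Fin 3) := Equiv.arrowCongr (Equiv.refl _) (Equiv.swap 1 2)
  have he : ∀ l j, e l j = Equiv.swap 1 2 (l j) := fun l j => rfl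
  have hw : ∀ l, weight (e l) = weight l := fun l => by
    refine Finset.prod_congr rfl fun j _ => ?_
    rw [he]
    generalize l j = a
    fin_cases a <;> simp [Equiv.swap_apply_def]
  have hn : ∀ l, noise (e l) = -noise l := fun l => by
    ext j
    simp only [noise, he, PiLp.neg_apply]
    generalize l j = a
    fin_cases a <;> simp [Equiv.swap_apply_def]
  have h := e.sum_comp fun l => weight l • noise l
  simp only [hw, hn, smul_neg, Finset.sum_neg_distrib] at h
  ext j
  have hj := congrArg (fun v : Space d => v j) h
  simp only [PiLp.neg_apply] at hj
  simp only [PiLp.zero_apply]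
  linarith

/-! ### The `L²` norm -/

/-- The `L²` norm on `ℝ^d`. -/
def l2norm {d : ℕ} (f : Space d → ℝ) : ℝ := √(∫ x, f x ^ 2)

theorem l2norm_nonneg {d : ℕ} (f : Space d → ℝ) : 0 ≤ l2norm f := Real.sqrt_nonneg _

theorem l2norm_sq {d : ℕ} (f : Space d → ℝ) : l2norm f ^ 2 = ∫ x, f x ^ 2 :=
  Real.sq_sqrt (integral_nonneg fun _ => sq_nonneg _)

theorem abs_integral_mul_le {d : ℕ} {f g : Space d → ℝ} (hf : MemLp f 2) (hg : MemLp g 2) :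
    |∫ x, f x * g x| ≤ l2norm f * l2norm g := by
  have h := integral_mul_norm_le_Lp_mul_Lq Real.HolderConjugate.two_two (f := f) (g := g)
    (by simpa using hf) (by simpa using hg)
  simp only [Real.rpow_ofNat, ← Real.sqrt_eq_rpow, Real.norm_eq_abs, sq_abs, ← abs_mul] at h
  exact (abs_integral_le_integral_abs).trans h

theorem memLp_two_of_continuous {d : ℕ} {f : Space d → ℝ} (hf : Continuous f)
    (hs : HasCompactSupport f) : MemLp f 2 :=
  hf.memLp_of_hasCompactSupport hs

theorem memLp_two_comp {d : ℕ} {K : NNReal} {y : Space d → Space d} (hy : AntilipschitzWith K y)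
    (hyc : Continuous y) {f : Space d → ℝ} (hf : Continuous f) (hf2 : MemLp f 2) :
    MemLp (fun x => f (y x)) 2 :=
  (memLp_two_iff_integrable_sq (hf.comp hyc).aestronglyMeasurable).2
    (integrable_comp_of_antilipschitzWith hy hyc hf2.integrable_sq)

theorem l2norm_comp_le {d : ℕ} {K : NNReal} (hK : 1 ≤ K) {y : Space d → Space d}
    (hy : AntilipschitzWith K y) (hyc : Continuous y) {f : Space d → ℝ} (hf2 : MemLp f 2) :
    l2norm (fun x => f (y x)) ≤ K ^ d * l2norm f := by
  have h := integral_comp_le_of_antilipschitzWith hy hyc hf2.integrable_sq fun x => sq_nonneg _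
  have hK' : (1 : ℝ) ≤ (K : ℝ) ^ d := one_le_pow₀ (by exact_mod_cast hK)
  rw [← l2norm_sq f] at h
  refine Real.sqrt_le_iff.2 ⟨by have := l2norm_nonneg f; positivity, h.trans ?_⟩
  rw [mul_pow]
  -- The change of variables yields `K^d` for the squared norm; `K ≥ 1` allows the cruder `K^(2d)`.
  exact mul_le_mul_of_nonneg_right (by nlinarith) (sq_nonneg _)

theorem l2norm_le_of_abs_le {d : ℕ} {f : Space d → ℝ} {ε R : ℝ}
    (hε : ∀ x, |f x| ≤ ε) (hR : ∀ x, x ∉ cube d R → f x = 0) :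
    l2norm f ≤ ε * √(volume.real (cube d R)) := by
  have hε0 : 0 ≤ ε := (abs_nonneg _).trans (hε 0)
  rw [l2norm, ← setIntegral_eq_integral_of_forall_compl_eq_zero (s := cube d R)
    fun x hx => by rw [hR x hx]; simp]
  have h : ∀ x ∈ cube d R, ‖f x ^ 2‖ ≤ ε ^ 2 := fun x _ => by
    rw [norm_pow]
    exact pow_le_pow_left₀ (norm_nonneg _) (hε x) 2
  have := norm_setIntegral_le_of_norm_le_const (μ := volume) (isCompact_cube d R).measure_lt_top h
  rw [← Real.sqrt_sq hε0, ← Real.sqrt_mul (sq_nonneg ε)]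
  exact Real.sqrt_le_sqrt ((Real.le_norm_self _).trans this)

/-! ### Stability and increments of the scheme -/

section Stability

variable {d p N : ℕ} {L dx : ℝ}

theorem memLp_gridDensity (hdx : 0 < dx) (hL : N * dx = L) (b : ℝ → Space d → Space d)
    (σ dt : ℝ) (m₀ : Space d → ℝ) (k : ℕ) : MemLp (gridDensity b σ dt m₀ p N L dx k) 2 := by
  rw [gridDensity_eq_galerkin hdx hL]
  exact memLp_two_of_continuous (continuous_galerkin _) (hasCompactSupport_galerkin hdx _)

/-- A projection is a contraction: test with the projected function itself and apply Cauchy–Schwarz.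
-/
theorem l2norm_gridDensity_zero_le (hdx : 0 < dx) (hL : N * dx = L)
    (b : ℝ → Space d → Space d) (σ dt : ℝ) {m₀ : Space d → ℝ} (hm₀ : Continuous m₀)
    (hm₀' : HasCompactSupport m₀) :
    l2norm (gridDensity b σ dt m₀ p N L dx 0) ≤ l2norm m₀ := by
  set f := gridDensity b σ dt m₀ p N L dx 0
  have hf : MemLp f 2 := memLp_gridDensity hdx hL ..
  have h := integral_galerkin_mul_gridDensity_zero (p := p) hdx hL b σ dt hm₀
    (coeff b σ dt m₀ p N L dx 0)
  rw [← gridDensity_eq_galerkin hdx hL] at h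
  have h2 : l2norm f ^ 2 ≤ l2norm f * l2norm m₀ := by
    rw [l2norm_sq]
    simp only [sq]
    rw [h]
    exact (le_abs_self _).trans (abs_integral_mul_le hf (memLp_two_of_continuous hm₀ hm₀'))
  rcases (l2norm_nonneg f).eq_or_lt with h0 | h0
  · rw [← h0]; exact l2norm_nonneg _
  · rw [sq] at h2
    exact le_of_mul_le_mul_left h2 h0

variable {b : ℝ → Space d → Space d} {σ dt : ℝ} {k : ℕ} {K : NNReal}

/-- Test the weak form with `m_{k+1}`, apply Cauchy–Schwarz and the change of variables for each
noise value, and divide by the norm of `m_{k+1}`. -/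
theorem l2norm_gridDensity_succ_le (hdx : 0 < dx) (hL : N * dx = L) (m₀ : Space d → ℝ)
    (hK : 1 ≤ K) (hyK : ∀ l, AntilipschitzWith K (cnStep b σ dt k l))
    (hy : ∀ l, Continuous (cnStep b σ dt k l)) :
    l2norm (gridDensity b σ dt m₀ p N L dx (k + 1)) ≤
      K ^ d * l2norm (gridDensity b σ dt m₀ p N L dx k) := by
  set f' := gridDensity b σ dt m₀ p N L dx (k + 1) with hf'def
  set f := gridDensity b σ dt m₀ p N L dx k
  have hf : MemLp f 2 := memLp_gridDensity hdx hL ..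
  have hf' : MemLp f' 2 := memLp_gridDensity hdx hL ..
  have hfc' : Continuous f' := by
    rw [hf'def, gridDensity_eq_galerkin hdx hL]
    exact continuous_galerkin _
  have h := integral_galerkin_mul_gridDensity_succ (p := p) hdx hL m₀ hy
    (coeff b σ dt m₀ p N L dx (k + 1))
  rw [← gridDensity_eq_galerkin hdx hL] at h
  have h2 : l2norm f' ^ 2 ≤ l2norm f' * (K ^ d * l2norm f) := by
    rw [l2norm_sq]
    simp only [sq]
    rw [h]
    calc ∑ l, weight l * ∫ x, f' (cnStep b σ dt k l x) * f x
        ≤ ∑ l : Fin d → Fin 3, weight l * (l2norm f' * (K ^ d * l2norm f)) := by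
          refine Finset.sum_le_sum fun l _ => mul_le_mul_of_nonneg_left ?_ (weight_nonneg l)
          refine (le_abs_self _).trans ((abs_integral_mul_le
            (memLp_two_comp (hyK l) (hy l) hfc' hf') hf).trans ?_)
          have := mul_le_mul_of_nonneg_right (l2norm_comp_le hK (hyK l) (hy l) hf')
            (l2norm_nonneg f)
          exact this.trans (le_of_eq (by ring))
      _ = _ := by rw [← Finset.sum_mul, sum_weight, one_mul]
  rcases (l2norm_nonneg f').eq_or_lt with h0 | h0
  · rw [← h0]
    have := l2norm_nonneg f
    positivity
  · rw [sq] at h2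
    exact le_of_mul_le_mul_left h2 h0

theorem abs_integral_mul_gridDensity_succ_sub_le (hdx : 0 < dx) (hL : N * dx = L)
    (m₀ : Space d → ℝ) (hK : 1 ≤ K) (hyK : ∀ l, AntilipschitzWith K (cnStep b σ dt k l))
    (hy : ∀ l, Continuous (cnStep b σ dt k l)) {φ : Space d → ℝ} (hφ : Continuous φ)
    (hφs : HasCompactSupport φ) (w : GridIndex d N → ℝ) {ε δ R A : ℝ}
    (he : ∀ x, |φ x - galerkin p N dx w x| ≤ ε)
    (he₀ : ∀ x, x ∉ cube d R → φ x - galerkin p N dx w x = 0)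
    (hδ : ∀ x, |∑ l, weight l * φ (cnStep b σ dt k l x) - φ x| ≤ δ)
    (hδ₀ : ∀ x, x ∉ cube d R → ∑ l, weight l * φ (cnStep b σ dt k l x) - φ x = 0)
    (hA : l2norm (gridDensity b σ dt m₀ p N L dx k) ≤ A)
    (hA' : l2norm (gridDensity b σ dt m₀ p N L dx (k + 1)) ≤ A) :
    |(∫ x, φ x * gridDensity b σ dt m₀ p N L dx (k + 1) x) -
      ∫ x, φ x * gridDensity b σ dt m₀ p N L dx k x| ≤
      ((1 + K ^ d) * ε + δ) * √(volume.real (cube d R)) * A := by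
  set f' := gridDensity b σ dt m₀ p N L dx (k + 1)
  set f := gridDensity b σ dt m₀ p N L dx k
  have hf : MemLp f 2 := memLp_gridDensity hdx hL ..
  have hf' : MemLp f' 2 := memLp_gridDensity hdx hL ..
  set ψ := galerkin p N dx w
  have hψ : Continuous ψ := continuous_galerkin w
  have hψ2 : MemLp ψ 2 := memLp_two_of_continuous hψ (hasCompactSupport_galerkin hdx w)
  have hφ2 : MemLp φ 2 := memLp_two_of_continuous hφ hφs
  set e : Space d → ℝ := fun x => φ x - ψ x
  have hec : Continuous e := hφ.sub hψ
  have he2 : MemLp e 2 := hφ2.sub hψ2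
  have hφy : ∀ l, MemLp (fun x => φ (cnStep b σ dt k l x)) 2 := fun l =>
    memLp_two_comp (hyK l) (hy l) hφ hφ2
  have hψy : ∀ l, MemLp (fun x => ψ (cnStep b σ dt k l x)) 2 := fun l =>
    memLp_two_comp (hyK l) (hy l) hψ hψ2
  have hey : ∀ l, MemLp (fun x => e (cnStep b σ dt k l x)) 2 := fun l =>
    memLp_two_comp (hyK l) (hy l) hec he2
  set g : Space d → ℝ := fun x => ∑ l, weight l * φ (cnStep b σ dt k l x) - φ x with hg
  have hg2 : MemLp g 2 :=
    (memLp_finsetSum _ fun l _ => (hφy l).const_mul (weight l)).sub hφ2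
  have hs : ∫ x, ψ x * f' x = ∑ l, weight l * ∫ x, ψ (cnStep b σ dt k l x) * f x :=
    integral_galerkin_mul_gridDensity_succ (p := p) hdx hL m₀ hy w
  have i1 : ∫ x, φ x * f' x = (∫ x, e x * f' x) + ∫ x, ψ x * f' x := by
    refine Eq.trans ?_ (integral_add (he2.integrable_mul hf') (hψ2.integrable_mul hf'))
    congr 1; ext x; simp only [e]; ring
  have i2 : ∀ l, ∫ x, ψ (cnStep b σ dt k l x) * f x =
      (∫ x, φ (cnStep b σ dt k l x) * f x) - ∫ x, e (cnStep b σ dt k l x) * f x := fun l => by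
    refine Eq.trans ?_ (integral_sub ((hφy l).integrable_mul hf) ((hey l).integrable_mul hf))
    congr 1; ext x; simp only [e]; ring
  have i3 : ∫ x, g x * f x =
      (∑ l, weight l * ∫ x, φ (cnStep b σ dt k l x) * f x) - ∫ x, φ x * f x := by
    have hi : ∀ l, Integrable fun x => weight l * (φ (cnStep b σ dt k l x) * f x) := fun l =>
      ((hφy l).integrable_mul hf).const_mul _
    simp only [← integral_const_mul]
    rw [← integral_finsetSum _ fun l _ => hi l]
    refine Eq.trans ?_ (integral_sub (integrable_finsetSum _ fun l _ => hi l)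
      (hφ2.integrable_mul hf))
    congr 1; ext x
    simp only [hg, sub_mul, Finset.sum_mul, mul_assoc]
  -- The weak form holds only for the Galerkin function `ψ`. Replacing `φ` by `ψ` at the new time,
  -- and `ψ ∘ y` by `φ ∘ y` at the old one, produces the two terms in `e`; the consistency defect
  -- `g` remains.
  have hdecomp : (∫ x, φ x * f' x) - ∫ x, φ x * f x = (∫ x, e x * f' x) +
      (∫ x, g x * f x) - ∑ l, weight l * ∫ x, e (cnStep b σ dt k l x) * f x := by
    rw [i1, hs, i3]
    simp only [i2, mul_sub, Finset.sum_sub_distrib]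
    ring
  have hA0 : 0 ≤ A := (l2norm_nonneg _).trans hA
  have hε0 : 0 ≤ ε := (abs_nonneg _).trans (he 0)
  have hδ0 : 0 ≤ δ := (abs_nonneg _).trans (hδ 0)
  set V := √(volume.real (cube d R))
  have hV : 0 ≤ V := Real.sqrt_nonneg _
  have le : l2norm e ≤ ε * V := l2norm_le_of_abs_le he he₀
  have lg : l2norm g ≤ δ * V := l2norm_le_of_abs_le hδ hδ₀
  have b1 : |∫ x, e x * f' x| ≤ ε * V * A :=
    (abs_integral_mul_le he2 hf').trans (mul_le_mul le hA' (l2norm_nonneg _) (by positivity))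
  have b2 : |∫ x, g x * f x| ≤ δ * V * A :=
    (abs_integral_mul_le hg2 hf).trans (mul_le_mul lg hA (l2norm_nonneg _) (by positivity))
  have b3 : |∑ l, weight l * ∫ x, e (cnStep b σ dt k l x) * f x| ≤ K ^ d * (ε * V) * A := by
    calc _ ≤ ∑ l, |weight l * ∫ x, e (cnStep b σ dt k l x) * f x| :=
          Finset.abs_sum_le_sum_abs _ _
      _ ≤ ∑ l : Fin d → Fin 3, weight l * (K ^ d * (ε * V) * A) := by
          refine Finset.sum_le_sum fun l _ => ?_
          rw [abs_mul, abs_of_nonneg (weight_nonneg l)]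
          refine mul_le_mul_of_nonneg_left ?_ (weight_nonneg l)
          refine (abs_integral_mul_le (hey l) hf).trans
            (mul_le_mul ?_ hA (l2norm_nonneg _) (by positivity))
          exact (l2norm_comp_le hK (hyK l) (hy l) he2).trans
            (mul_le_mul_of_nonneg_left le (by positivity))
      _ = _ := by rw [← Finset.sum_mul, sum_weight, one_mul]
  rw [hdecomp]
  calc _ ≤ |∫ x, e x * f' x| + |∫ x, g x * f x| +
        |∑ l, weight l * ∫ x, e (cnStep b σ dt k l x) * f x| :=
        (abs_sub _ _).trans (add_le_add_left (abs_add_le _ _) _)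
    _ ≤ ε * V * A + δ * V * A + K ^ d * (ε * V) * A := add_le_add (add_le_add b1 b2) b3
    _ = _ := by ring

end Stability

/-! ### Consistency of the time discretization -/

theorem exists_norm_noise_le (d : ℕ) : ∃ ν : ℝ, 0 ≤ ν ∧ ∀ l : Fin d → Fin 3, ‖noise l‖ ≤ ν :=
  ⟨∑ l : Fin d → Fin 3, ‖noise l‖, Finset.sum_nonneg fun _ _ => norm_nonneg _, fun l =>
    Finset.single_le_sum (f := fun l : Fin d → Fin 3 => ‖noise l‖) (fun _ _ => norm_nonneg _)
      (Finset.mem_univ l)⟩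

/-- First-order Taylor expansion at `x`: the linear term averages to zero, the quadratic remainder
in a noise of size `√Δt` is `O(Δt)`, and so is the drift displacement. -/
theorem abs_sum_weight_mul_sub_le {d : ℕ} {φ : Space d → ℝ} {K₁ K₂ : NNReal} {σ dt M ν : ℝ}
    (hφ : Differentiable ℝ φ) (hφ₁ : LipschitzWith K₁ φ) (hφ₂ : LipschitzWith K₂ (fderiv ℝ φ))
    (hdt : 0 ≤ dt) (hν : ∀ l : Fin d → Fin 3, ‖noise l‖ ≤ ν) (x : Space d)
    (y : (Fin d → Fin 3) → Space d)
    (hy : ∀ l, ‖y l - x - (√dt * σ) • noise l‖ ≤ M * dt) :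
    |∑ l, weight l * φ (y l) - φ x| ≤ (K₁ * M + K₂ * (σ ^ 2 * ν ^ 2)) * dt := by
  set h : (Fin d → Fin 3) → Space d := fun l => (√dt * σ) • noise l with hh
  have hstep : ∀ l, |φ (y l) - φ x - fderiv ℝ φ x (h l)| ≤
      (K₁ * M + K₂ * (σ ^ 2 * ν ^ 2)) * dt := by
    intro l
    have h1 : |φ (y l) - φ (x + h l)| ≤ K₁ * (M * dt) := by
      have := hφ₁.dist_le_mul (y l) (x + h l)
      rw [Real.dist_eq, dist_eq_norm, ← sub_sub] at this
      exact this.trans (mul_le_mul_of_nonneg_left (hy l) K₁.2)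
    have h2 : |φ (x + h l) - φ x - fderiv ℝ φ x (h l)| ≤ K₂ * ‖h l‖ * ‖h l‖ := by
      -- On the ball of radius `‖h l‖` the derivative differs from its value at `x` by at most `K₂
      -- ‖h l‖`.
      have := (convex_closedBall x ‖h l‖).norm_image_sub_le_of_norm_fderiv_le' (𝕜 := ℝ) (f := φ)
        (C := K₂ * ‖h l‖) (φ := fderiv ℝ φ x) (x := x) (y := x + h l) (fun z _ => hφ z)
        (fun z hz => ?_) (by simp) (by simp)
      · simpa using this
      · rw [← dist_eq_norm]
        exact (hφ₂.dist_le_mul z x).trans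
          (mul_le_mul_of_nonneg_left (Metric.mem_closedBall.1 hz) K₂.2)
    have h3 : ‖h l‖ * ‖h l‖ ≤ σ ^ 2 * ν ^ 2 * dt := by
      have : ‖h l‖ * ‖h l‖ = σ ^ 2 * ‖noise l‖ ^ 2 * dt := by
        rw [← sq, hh, norm_smul, mul_pow, norm_mul, mul_pow, Real.norm_eq_abs, Real.norm_eq_abs,
          sq_abs, sq_abs, Real.sq_sqrt hdt]
        ring
      rw [this]
      have := hν l
      gcongr
    have h4 := mul_le_mul_of_nonneg_left h3 K₂.2
    calc |φ (y l) - φ x - fderiv ℝ φ x (h l)|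
        = |(φ (y l) - φ (x + h l)) + (φ (x + h l) - φ x - fderiv ℝ φ x (h l))| := by
          congr 1; ring
      _ ≤ _ := abs_add_le _ _
      _ ≤ K₁ * (M * dt) + K₂ * (σ ^ 2 * ν ^ 2 * dt) := by
          refine add_le_add h1 (h2.trans ?_)
          rw [mul_assoc]
          exact h4
      _ = _ := by ring
  have hzero : ∑ l, weight l * fderiv ℝ φ x (h l) = 0 := by
    have : ∑ l, weight l • h l = 0 := by
      simp only [hh, smul_comm (weight _)]
      rw [← Finset.smul_sum, sum_weight_smul_noise, smul_zero]
    simpa [map_sum] using congrArg (fderiv ℝ φ x) this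
  have hsum : ∑ l, weight l * φ (y l) - φ x =
      ∑ l, weight l * (φ (y l) - φ x - fderiv ℝ φ x (h l)) := by
    simp only [mul_sub, Finset.sum_sub_distrib, hzero, ← Finset.sum_mul, sum_weight]
    ring
  rw [hsum]
  calc _ ≤ ∑ l, |weight l * (φ (y l) - φ x - fderiv ℝ φ x (h l))| :=
        Finset.abs_sum_le_sum_abs _ _
    _ ≤ ∑ l : Fin d → Fin 3, weight l * ((K₁ * M + K₂ * (σ ^ 2 * ν ^ 2)) * dt) := by
        refine Finset.sum_le_sum fun l _ => ?_
        rw [abs_mul, abs_of_nonneg (weight_nonneg l)]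
        exact mul_le_mul_of_nonneg_left (hstep l) (weight_nonneg l)
    _ = _ := by rw [← Finset.sum_mul, sum_weight, one_mul]

theorem sum_weight_mul_sub_eq_zero {d : ℕ} {φ : Space d → ℝ} {R r : ℝ} (hr : 0 ≤ r)
    (hφ : ∀ x, x ∉ cube d R → φ x = 0) {x : Space d} (y : (Fin d → Fin 3) → Space d)
    (hy : ∀ l, ‖y l - x‖ ≤ r) (hx : x ∉ cube d (R + r)) :
    ∑ l, weight l * φ (y l) - φ x = 0 := by
  obtain ⟨j, hj⟩ : ∃ j, R + r < |x j| := by simpa [cube] using hx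
  have h : ∀ z, ‖z - x‖ ≤ r → φ z = 0 := fun z hz => by
    refine hφ _ fun hmem => ?_
    have h1 := hmem j
    have h2 : |z j - x j| ≤ r := (PiLp.norm_apply_le (z - x) j).trans hz
    have h3 := abs_sub_abs_le_abs_sub (x j) (z j)
    rw [abs_sub_comm] at h3
    linarith
  rw [h x (by simpa using hr)]
  simp [h _ (hy _)]

/-! ### The width of the computational domain tends to infinity -/

/-- The trajectory of the Crank-Nicolson scheme with the same value of the noise at all steps. -/
def trajectory {d : ℕ} (b : ℝ → Space d → Space d) (σ dt : ℝ) (l : Fin d → Fin 3) :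
    ℕ → Space d → Space d
  | 0, x => x
  | k + 1, x => cnStep b σ dt k l (trajectory b σ dt l k x)

/-- As every weight is positive, `μ_{k+1}` dominates a positive multiple of the image of `μ_k` under
the step with noise `l`; null sets therefore pull back along the constant-noise trajectory. -/
theorem semidiscrete_zero_preimage_trajectory {d : ℕ} {b : ℝ → Space d → Space d} {σ dt : ℝ}
    {m₀ : Space d → ℝ} (l : Fin d → Fin 3) {n : ℕ}
    (hy : ∀ k < n, ∀ l, Continuous (cnStep b σ dt k l)) :
    ∀ k ≤ n, ∀ A, MeasurableSet A → semidiscrete b σ dt m₀ k A = 0 →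
      semidiscrete b σ dt m₀ 0 (trajectory b σ dt l k ⁻¹' A) = 0
  | 0, _, _, _, h => h
  | k + 1, hk, A, hA, h => by
    have hc := (hy k (by omega) l).measurable
    rw [semidiscrete, Measure.finsetSum_apply, Finset.sum_eq_zero_iff] at h
    have hl := h l (Finset.mem_univ l)
    rw [Measure.smul_apply, smul_eq_mul, mul_eq_zero, Measure.map_apply hc hA] at hl
    have hl' := hl.resolve_left (by simpa using weight_pos l)
    exact semidiscrete_zero_preimage_trajectory l hy k (by omega) _ (hc hA) hl'

theorem norm_trajectory_sub_le {d : ℕ} {b : ℝ → Space d → Space d} {σ dt M : ℝ}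
    (l : Fin d → Fin 3) {n : ℕ}
    (hy : ∀ k < n, ∀ x, ‖cnStep b σ dt k l x - x - (√dt * σ) • noise l‖ ≤ M * dt) (x : Space d) :
    ∀ k ≤ n, ‖trajectory b σ dt l k x - x - (k * (√dt * σ)) • noise l‖ ≤ k * (M * dt)
  | 0, _ => by simp [trajectory]
  | k + 1, hk => by
    have h1 := norm_trajectory_sub_le l hy x k (by omega)
    have h2 := hy k (by omega) (trajectory b σ dt l k x)
    have e : trajectory b σ dt l (k + 1) x - x - ((k + 1 : ℕ) * (√dt * σ)) • noise l =
        (trajectory b σ dt l k x - x - (k * (√dt * σ)) • noise l) +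
        (cnStep b σ dt k l (trajectory b σ dt l k x) - trajectory b σ dt l k x -
          (√dt * σ) • noise l) := by
      simp only [trajectory]
      push_cast
      rw [add_mul, one_mul, add_smul]
      abel
    rw [e]
    refine (norm_add_le _ _).trans ((add_le_add h1 h2).trans (le_of_eq ?_))
    push_cast
    ring

theorem exists_ne_zero_of_semidiscrete_zero {d : ℕ} {b : ℝ → Space d → Space d} {σ dt : ℝ}
    {m₀ : Space d → ℝ} (hm₀ : InitialDensity m₀) {A : Set (Space d)}
    (hA : semidiscrete b σ dt m₀ 0 Aᶜ = 0) : ∃ x ∈ A, m₀ x ≠ 0 := by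
  by_contra! hcon
  obtain ⟨C, r, hr, -, hold⟩ := hm₀.holder
  have hcont : Continuous m₀ := hold.continuous hr
  have h : ∀ᵐ x ∂(semidiscrete b σ dt m₀ 0), x ∈ A := hA
  rw [semidiscrete, ae_withDensity_iff (by fun_prop)] at h
  have h0 : m₀ =ᵐ[volume] 0 := by
    filter_upwards [h] with x hx
    by_contra hne
    have hpos : 0 < m₀ x := lt_of_le_of_ne (hm₀.nonneg x) (Ne.symm hne)
    exact hne (hcon x (hx (by simpa using hpos)))
  have := integral_congr_ae h0
  simp [hm₀.mass_one] at this

theorem natCast_mul_div_mem_Icc {T : ℝ} (hT : 0 < T) {n k : ℕ} (hk : k ≤ n) :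
    (k : ℝ) * (T / n) ∈ Set.Icc 0 T := by
  refine ⟨by positivity, ?_⟩
  rcases Nat.eq_zero_or_pos n with rfl | hn
  · simp [hT.le]
  · have hn' : (0 : ℝ) < n := by exact_mod_cast hn
    have : (k : ℝ) ≤ n := by exact_mod_cast hk
    calc (k : ℝ) * (T / n) ≤ n * (T / n) := by gcongr
      _ = T := by field_simp

/-- Under constant noise `√3` in every coordinate, `n` steps move a point by `|σ| √3 √(T n)` along
an axis, up to a drift of at most `M T`. Some point with `m₀ ≠ 0` must end in the cube of half-width
`L n`, so `L n` grows at least like `√n`. -/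
theorem tendsto_halfWidth {d : ℕ} (hd : 0 < d) {T σ : ℝ} (hT : 0 < T) (hσ : σ ≠ 0)
    {b : ℝ → Space d → Space d} (hb : AdmissibleDrift T b) {m₀ : Space d → ℝ}
    (hm₀ : InitialDensity m₀) {L : ℕ → ℝ} (hL : AdmissibleHalfWidth T σ b m₀ L) :
    Filter.Tendsto L Filter.atTop Filter.atTop := by
  obtain ⟨M, hM⟩ := hb.bounded
  obtain ⟨C, hC, hlip⟩ := hb.lipschitz
  obtain ⟨R, hR⟩ := hm₀.compact_support.isBounded.subset_closedBall 0
  have hdt : Filter.Tendsto (fun n : ℕ => C * (T / n)) Filter.atTop (nhds 0) := by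
    simpa using (tendsto_const_div_atTop_nhds_zero_nat T).const_mul C
  have hlow : Filter.Tendsto (fun n : ℕ => (|σ| * √3 * √T) * √(n : ℝ) - (R + M * T))
      Filter.atTop Filter.atTop := by
    refine Filter.tendsto_atTop_add_const_right _ _ ?_
    refine Filter.Tendsto.const_mul_atTop (by positivity) ?_
    exact Real.tendsto_sqrt_atTop.comp tendsto_natCast_atTop_atTop
  refine Filter.tendsto_atTop_mono' _ ?_ hlow
  filter_upwards [hL.support, hdt.eventually_le_const zero_lt_one, Filter.eventually_gt_atTop 0]
    with n hsupp hCdt hn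
  have hn' : (0 : ℝ) < n := by exact_mod_cast hn
  set dt := T / n with hdt_def
  have hdt0 : 0 < dt := by positivity
  have htime : ∀ k ≤ n, (k : ℝ) * dt ∈ Set.Icc 0 T := fun k hk => natCast_mul_div_mem_Icc hT hk
  have htime' : ∀ k < n, ((k : ℝ) + 1) * dt ∈ Set.Icc 0 T := fun k hk => by
    exact_mod_cast htime (k + 1) hk
  let l : Fin d → Fin 3 := fun _ => 1
  have hy : ∀ k < n, ∀ l, Continuous (cnStep b σ dt k l) := fun k hk l =>
    continuous_cnStep hdt0 hCdt (hlip _ (htime k hk.le)) (hlip _ (htime' k hk)) l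
  -- The complement of the support is null, hence so is the complement of the larger cube.
  have hz : semidiscrete b σ dt m₀ n (cube d (L n))ᶜ = 0 :=
    measure_mono_null (Set.compl_subset_compl.2 (hsupp n le_rfl)) Measure.measure_compl_support
  have hz' := semidiscrete_zero_preimage_trajectory l hy n le_rfl _
    (isCompact_cube d (L n)).measurableSet.compl hz
  rw [Set.preimage_compl] at hz'
  obtain ⟨x, hx, hx0⟩ := exists_ne_zero_of_semidiscrete_zero hm₀ hz'
  have hxR : ‖x‖ ≤ R := by simpa using hR (subset_tsupport _ hx0)
  have htr := norm_trajectory_sub_le l (σ := σ) (M := M) (fun k hk x =>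
    norm_cnStep_sub_sub_le hdt0 hCdt (hlip _ (htime' k hk)) (hM _ (htime k hk.le))
      (hM _ (htime' k hk)) l x) x n le_rfl
  set y := trajectory b σ dt l n x
  let j : Fin d := ⟨0, hd⟩
  have h1 : |y j - x j - n * (√dt * σ) * √3| ≤ n * (M * dt) := by
    refine le_trans ?_ htr
    have := PiLp.norm_apply_le (y - x - ((n : ℝ) * (√dt * σ)) • noise l) j
    simpa [noise, l] using this
  have h2 : |y j| ≤ L n := hx j
  have h3 : |x j| ≤ R := (PiLp.norm_apply_le x j).trans hxR
  have h4 : n * (M * dt) = M * T := by rw [hdt_def]; field_simp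
  have h5 : |(n : ℝ) * (√dt * σ) * √3| = |σ| * √3 * √T * √(n : ℝ) := by
    rw [abs_mul, abs_mul, abs_mul, abs_of_nonneg hn'.le, abs_of_nonneg (Real.sqrt_nonneg dt),
      abs_of_nonneg (Real.sqrt_nonneg 3), hdt_def, Real.sqrt_div hT.le]
    have : (n : ℝ) = √(n : ℝ) * √(n : ℝ) := (Real.mul_self_sqrt hn'.le).symm
    have hs : √(n : ℝ) ≠ 0 := (Real.sqrt_pos.2 hn').ne'
    field_simp
    rw [sq, ← this]
  have h6 : |(n : ℝ) * (√dt * σ) * √3| ≤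
      |y j| + |x j| + |y j - x j - n * (√dt * σ) * √3| := by
    calc _ = |(y j - x j) - (y j - x j - n * (√dt * σ) * √3)| := by congr 1; ring
      _ ≤ _ := (abs_sub _ _).trans (add_le_add_left (abs_sub _ _) _)
  linarith

/-! ### Piecewise linear interpolation in time -/

theorem max_zero_one_sub_abs (s : ℝ) :
    max 0 (1 - |s|) = max 0 (min (s + 1) 1) - max 0 (min s 1) := by
  rcases le_total 0 s with h | h
  · rw [abs_of_nonneg h, min_eq_right (by linarith : (1 : ℝ) ≤ s + 1), max_eq_right zero_le_one]
    rcases le_total s 1 with h1 | h1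
    · rw [min_eq_left h1, max_eq_right h, max_eq_right (by linarith)]
    · rw [min_eq_right h1, max_eq_left (by linarith), max_eq_right zero_le_one, sub_self]
  · rw [abs_of_nonpos h, min_eq_left (by linarith : s + 1 ≤ 1), min_eq_left (by linarith : s ≤ 1),
      max_eq_left h, sub_zero, sub_neg_eq_add, add_comm]

/-- Each hat is a difference of two consecutive clamped ramps, so summation by parts moves the
difference onto the values `a k`. -/
theorem sum_hat_mul_eq (a : ℕ → ℝ) (s : ℝ) (n : ℕ) :
    ∑ k ∈ Finset.range (n + 1), max 0 (1 - |s - k|) * a k =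
      max 0 (min (s + 1) 1) * a 0 +
        ∑ k ∈ Finset.range n, (a (k + 1) - a k) * max 0 (min (s - k) 1) -
        max 0 (min (s - n) 1) * a n := by
  induction n with
  | zero => simp [max_zero_one_sub_abs s, sub_mul]
  | succ n ih =>
    rw [Finset.sum_range_succ, ih, Finset.sum_range_succ _ n, max_zero_one_sub_abs]
    have : s - (n + 1 : ℕ) + 1 = s - n := by push_cast; ring
    rw [this]
    ring

theorem sum_clamp_eq {s : ℝ} (hs : 0 ≤ s) (n : ℕ) :
    ∑ k ∈ Finset.range n, max 0 (min (s - k) 1) = min s n := by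
  induction n with
  | zero => simp [hs]
  | succ n ih =>
    rw [Finset.sum_range_succ, ih]
    push_cast
    rcases le_total s n with h | h
    · rw [min_eq_left h, min_eq_left (by linarith : s - n ≤ 1), max_eq_left (by linarith), add_zero,
        min_eq_left (by linarith)]
    · rw [min_eq_right h]
      rcases le_total s (n + 1) with h1 | h1
      · rw [min_eq_left h1, min_eq_left (by linarith), max_eq_right (by linarith)]
        ring
      · rw [min_eq_right h1, min_eq_right (by linarith), max_eq_right zero_le_one]

theorem abs_sum_hat_mul_le {a : ℕ → ℝ} {n : ℕ} {A s : ℝ} (hA : ∀ k ≤ n, |a k| ≤ A) :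
    |∑ k ∈ Finset.range (n + 1), max 0 (1 - |s - k|) * a k| ≤ A := by
  have hA0 : 0 ≤ A := (abs_nonneg _).trans (hA 0 (Nat.zero_le n))
  have h1 : ∑ k ∈ Finset.range (n + 1), max 0 (1 - |s - k|) ≤ 1 := by
    have := sum_hat_mul_eq (fun _ => 1) s n
    simp only [mul_one, sub_self, zero_mul, Finset.sum_const_zero, add_zero] at this
    rw [this]
    have h2 : max 0 (min (s + 1) 1) ≤ 1 := max_le zero_le_one (min_le_right _ _)
    have h3 : 0 ≤ max 0 (min (s - n) 1) := le_max_left _ _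
    linarith
  calc _ ≤ ∑ k ∈ Finset.range (n + 1), |max 0 (1 - |s - k|) * a k| := Finset.abs_sum_le_sum_abs _ _
    _ ≤ ∑ k ∈ Finset.range (n + 1), max 0 (1 - |s - k|) * A := by
        refine Finset.sum_le_sum fun k hk => ?_
        rw [abs_mul, abs_of_nonneg (le_max_left _ _)]
        exact mul_le_mul_of_nonneg_left (hA k (by rw [Finset.mem_range] at hk; omega))
          (le_max_left _ _)
    _ ≤ A := by
        rw [← Finset.sum_mul]
        exact mul_le_of_le_one_left hA0 h1

/-- On `[0, n]` the interpolation is `a 0` plus the increments of `a` times ramps; the ramps are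
monotone and add up to `s`, so a bound on the increments is a Lipschitz constant. -/
theorem abs_sum_hat_mul_sub_le {a : ℕ → ℝ} {n : ℕ} {δ s t : ℝ}
    (hδ : ∀ k < n, |a (k + 1) - a k| ≤ δ) (hs : s ∈ Set.Icc (0 : ℝ) n)
    (ht : t ∈ Set.Icc (0 : ℝ) n) :
    |∑ k ∈ Finset.range (n + 1), max 0 (1 - |s - k|) * a k -
      ∑ k ∈ Finset.range (n + 1), max 0 (1 - |t - k|) * a k| ≤ δ * |s - t| := by
  wlog hst : t ≤ s generalizing s t
  · rw [abs_sub_comm, abs_sub_comm s]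
    exact this ht hs (le_of_not_ge hst)
  have hform : ∀ r ∈ Set.Icc (0 : ℝ) n, ∑ k ∈ Finset.range (n + 1), max 0 (1 - |r - k|) * a k =
      a 0 + ∑ k ∈ Finset.range n, (a (k + 1) - a k) * max 0 (min (r - k) 1) := fun r hr => by
    rw [sum_hat_mul_eq, min_eq_right (by linarith [hr.1]), max_eq_right zero_le_one,
      max_eq_left ((min_le_left _ _).trans (by linarith [hr.2]))]
    ring
  rw [hform s hs, hform t ht, add_sub_add_left_eq_sub, ← Finset.sum_sub_distrib]
  simp only [← mul_sub]
  calc _ ≤ ∑ k ∈ Finset.range n,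
        |(a (k + 1) - a k) * (max 0 (min (s - k) 1) - max 0 (min (t - k) 1))| :=
        Finset.abs_sum_le_sum_abs _ _
    _ ≤ ∑ k ∈ Finset.range n, δ * (max 0 (min (s - k) 1) - max 0 (min (t - k) 1)) := by
        refine Finset.sum_le_sum fun k hk => ?_
        have hmono : max 0 (min (t - k) 1) ≤ max 0 (min (s - k) 1) := by gcongr
        rw [abs_mul, abs_of_nonneg (sub_nonneg.2 hmono)]
        exact mul_le_mul_of_nonneg_right (hδ k (Finset.mem_range.1 hk)) (sub_nonneg.2 hmono)
    _ = δ * |s - t| := by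
        rw [← Finset.mul_sum, Finset.sum_sub_distrib, sum_clamp_eq hs.1, sum_clamp_eq ht.1,
          min_eq_left hs.2, min_eq_left ht.2, abs_of_nonneg (sub_nonneg.2 hst)]

theorem curve_apply {d : ℕ} (T σ : ℝ) (b : ℝ → Space d → Space d) (m₀ : Space d → ℝ) (p n N : ℕ)
    (L : ℝ) (t : Set.Icc (0 : ℝ) T) (φ : 𝓓((⊤ : TopologicalSpace.Opens (Space d)), ℝ)) :
    curve T σ b m₀ p n N L t φ =
      ∑ k ∈ Finset.range (n + 1), max 0 (1 - |(t : ℝ) / (T / n) - k|) *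
        ∫ x, φ x * gridDensity b σ (T / n) m₀ p N L (L / N) k x := by
  change regular (density b σ (T / n) m₀ p n N L (L / N) t) φ = _
  rw [regular_apply (integrable_density ..).locallyIntegrable]
  simp only [density, Finset.mul_sum, ← integral_const_mul]
  rw [integral_finsetSum]
  · simp only [mul_left_comm]
  · intro k _
    simp only [mul_left_comm]
    exact (TestFunction.integrable_bilin (ContinuousLinearMap.mul ℝ ℝ)
      ((integrable_gridDensity ..).locallyIntegrable.locallyIntegrableOn _) φ).const_mul _

/-! ### Uniform estimates for the scheme -/

section Uniform

variable {d p : ℕ} {T σ C M : ℝ} {b : ℝ → Space d → Space d} {m₀ : Space d → ℝ}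

/-- Discrete Gronwall: the factor `(1 + 2 C Δt)^d` per step accumulates over at most `n = T/Δt`
steps to an exponential independent of the discretization. -/
theorem l2norm_gridDensity_le (hT : 0 < T) (hC : 0 < C)
    (hlip : ∀ t ∈ Set.Icc 0 T, ∀ x y, ‖b t x - b t y‖ ≤ C * ‖x - y‖) (hm₀ : Continuous m₀)
    (hm₀' : HasCompactSupport m₀) {n N : ℕ} (hn : 0 < n) (hCdt : C * (T / n) ≤ 1) {L dx : ℝ}
    (hdx : 0 < dx) (hL : N * dx = L) {k : ℕ} (hk : k ≤ n) :
    l2norm (gridDensity b σ (T / n) m₀ p N L dx k) ≤ Real.exp (2 * C * T * d) * l2norm m₀ := by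
  have hn' : (0 : ℝ) < n := by exact_mod_cast hn
  set dt := T / n with hdt
  have hdt0 : 0 < dt := by positivity
  have hc : 0 < C * dt := by positivity
  have key : ∀ k ≤ n, l2norm (gridDensity b σ dt m₀ p N L dx k) ≤
      ((1 + 2 * (C * dt)) ^ d) ^ k * l2norm m₀ := by
    intro k
    induction k with
    | zero =>
      intro _
      simpa using l2norm_gridDensity_zero_le hdx hL b σ dt hm₀ hm₀'
    | succ k ih =>
      intro hk
      have h₀ := hlip _ (natCast_mul_div_mem_Icc hT (n := n) (k := k) (by omega))
      have h₁ : ∀ x y, ‖b ((k + 1) * dt) x - b ((k + 1) * dt) y‖ ≤ C * ‖x - y‖ := by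
        have := hlip _ (natCast_mul_div_mem_Icc hT (n := n) (k := k + 1) hk)
        exact_mod_cast this
      have h := l2norm_gridDensity_succ_le (p := p) (K := (1 + 2 * (C * dt)).toNNReal) hdx hL m₀
        (by rw [Real.one_le_toNNReal]; linarith)
        (fun l => antilipschitzWith_cnStep (σ := σ) hC hdt0 hCdt h₀ h₁ l)
        (fun l => continuous_cnStep hdt0 hCdt h₀ h₁ l)
      rw [Real.coe_toNNReal _ (by positivity)] at h
      refine h.trans ((mul_le_mul_of_nonneg_left (ih (by omega)) (by positivity)).trans
        (le_of_eq ?_))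
      ring
  refine (key k hk).trans (mul_le_mul_of_nonneg_right ?_ (l2norm_nonneg _))
  have h1 : 1 + 2 * (C * dt) ≤ Real.exp (2 * (C * dt)) := by
    linarith [Real.add_one_le_exp (2 * (C * dt))]
  have hkn : (k : ℝ) ≤ n := by exact_mod_cast hk
  calc ((1 + 2 * (C * dt)) ^ d) ^ k ≤ (Real.exp (2 * (C * dt)) ^ d) ^ k := by gcongr
    _ = Real.exp (k * (d * (2 * (C * dt)))) := by rw [← Real.exp_nat_mul, ← Real.exp_nat_mul]
    _ ≤ Real.exp (n * (d * (2 * (C * dt)))) := by gcongr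
    _ = Real.exp (2 * C * T * d) := by
        congr 1
        rw [hdt]
        field_simp

/-- For a fixed test function, the increments of the scheme are `O(Δt)` as soon as the
computational domain contains the support of the test function. -/
theorem exists_abs_increment_le (hT : 0 < T) (hC : 0 < C)
    (hlip : ∀ t ∈ Set.Icc 0 T, ∀ x y, ‖b t x - b t y‖ ≤ C * ‖x - y‖)
    (hM : ∀ t ∈ Set.Icc 0 T, ∀ x, ‖b t x‖ ≤ M) (hm₀ : Continuous m₀)
    (hm₀' : HasCompactSupport m₀) (φ : Space d → ℝ) (hφ : ∀ n : ℕ, ContDiff ℝ n φ)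
    (hφs : HasCompactSupport φ) :
    ∃ κ R : ℝ, 0 ≤ κ ∧ ∀ (n N : ℕ) (L dx : ℝ), 0 < n → T / n ≤ 1 → C * (T / n) ≤ 1 → 0 < dx →
      N * dx = L → dx ^ (2 * p + 1 + 1) ≤ T / n → R ≤ L → ∀ k < n,
      |(∫ x, φ x * gridDensity b σ (T / n) m₀ p N L dx (k + 1) x) -
        ∫ x, φ x * gridDensity b σ (T / n) m₀ p N L dx k x| ≤ κ * (T / n) := by
  have hM0 : 0 ≤ M := (norm_nonneg _).trans (hM 0 ⟨le_rfl, hT.le⟩ 0)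
  obtain ⟨ν, hν0, hν⟩ := exists_norm_noise_le d
  obtain ⟨Ci, hCi0, hCi⟩ := exists_abs_interpolant_sub_le d p
  obtain ⟨K₁, hK₁⟩ := ContDiff.lipschitzWith_of_hasCompactSupport hφs (hφ 1) (by simp)
  obtain ⟨K₂, hK₂⟩ := ContDiff.lipschitzWith_of_hasCompactSupport (hφs.fderiv (𝕜 := ℝ))
    ((hφ 2).fderiv_right (m := 1) (by norm_num)) (by simp)
  obtain ⟨B, hB⟩ := ((hφ (2 * p + 1 + 1)).continuous_iteratedFDeriv
    (m := 2 * p + 1 + 1) le_rfl).bounded_above_of_compact_support (hφs.iteratedFDeriv (𝕜 := ℝ) _)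
  have hB0 : 0 ≤ B := (norm_nonneg _).trans (hB 0)
  obtain ⟨R, hR⟩ := hφs.isBounded.subset_closedBall 0
  have hsupp : ∀ x, x ∉ cube d R → φ x = 0 := fun x hx => by
    by_contra hne
    refine hx fun j => (PiLp.norm_apply_le x j).trans ?_
    simpa using hR (subset_tsupport _ hne)
  -- With `Δx ≤ 1` and `Δt ≤ 1`, `p + 1` bounds the reach of a basis function and `M + |σ| ν` the
  -- length of a step, so all errors live in `cube d (R + r)`.
  set r : ℝ := (p + 1) + (M + |σ| * ν) with hr
  have hr0 : 0 ≤ r := by positivity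
  set D : ℝ := K₁ * M + K₂ * (σ ^ 2 * ν ^ 2)
  set A := Real.exp (2 * C * T * d) * l2norm m₀
  have hA0 : 0 ≤ A := mul_nonneg (Real.exp_pos _).le (l2norm_nonneg _)
  -- Here `3 ^ d` bounds `(1 + 2 C Δt)^d` when `C Δt ≤ 1`.
  refine ⟨((1 + 3 ^ d) * (Ci * B) + D) * √(volume.real (cube d (R + r))) * A, R, by positivity, ?_⟩
  intro n N L dx hn hdt1 hCdt hdx hL hdxt hRL k hk
  have hn' : (0 : ℝ) < n := by exact_mod_cast hn
  have hAk := fun j (hj : j ≤ n) => l2norm_gridDensity_le (p := p) (σ := σ) hT hC hlip hm₀ hm₀' hn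
    hCdt hdx hL hj
  have ht₀ := natCast_mul_div_mem_Icc hT (n := n) (k := k) hk.le
  have ht₁ : ((k : ℝ) + 1) * (T / n) ∈ Set.Icc 0 T := by
    exact_mod_cast natCast_mul_div_mem_Icc hT (n := n) (k := k + 1) hk
  set dt := T / n with hdt
  have hdt0 : 0 < dt := by positivity
  have hc : 0 < C * dt := by positivity
  have hdx1 : dx ≤ 1 := by
    by_contra! h
    exact absurd (hdxt.trans hdt1) (not_le.2 (one_lt_pow₀ h (by omega)))
  have hcube : ∀ {u v : ℝ}, u ≤ v → cube d u ⊆ cube d v := fun huv x hx j => (hx j).trans huv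
  have hyx : ∀ l x, ‖cnStep b σ dt k l x - x - (√dt * σ) • noise l‖ ≤ M * dt := fun l x =>
    norm_cnStep_sub_sub_le hdt0 hCdt (hlip _ ht₁) (hM _ ht₀) (hM _ ht₁) l x
  have hyx' : ∀ l x, ‖cnStep b σ dt k l x - x‖ ≤ M + |σ| * ν := fun l x => by
    have h1 : ‖(√dt * σ) • noise l‖ ≤ |σ| * ν := by
      rw [norm_smul, norm_mul, Real.norm_of_nonneg (Real.sqrt_nonneg _), Real.norm_eq_abs]
      have h2 : √dt ≤ 1 := Real.sqrt_le_one.2 hdt1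
      have h3 : √dt * |σ| ≤ |σ| := mul_le_of_le_one_left (abs_nonneg _) h2
      exact mul_le_mul h3 (hν l) (norm_nonneg _) (abs_nonneg _)
    have h2 : M * dt ≤ M := mul_le_of_le_one_right hM0 hdt1
    have h3 := norm_le_norm_add_norm_sub' (cnStep b σ dt k l x - x) ((√dt * σ) • noise l)
    linarith [hyx l x]
  have hK3 : ((1 + 2 * (C * dt)).toNNReal : ℝ) ^ d ≤ 3 ^ d := by
    rw [Real.coe_toNNReal _ (by positivity)]
    gcongr
    linarith
  have hmain := abs_integral_mul_gridDensity_succ_sub_le (p := p) (b := b) (σ := σ) (dt := dt)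
    (k := k) (K := (1 + 2 * (C * dt)).toNNReal) hdx hL m₀
    (by rw [Real.one_le_toNNReal]; linarith)
    (fun l => antilipschitzWith_cnStep (σ := σ) hC hdt0 hCdt (hlip _ ht₀) (hlip _ ht₁) l)
    (fun l => continuous_cnStep hdt0 hCdt (hlip _ ht₀) (hlip _ ht₁) l)
    (hφ 0).continuous hφs (fun i => φ (gridPoint dx i)) (ε := Ci * B * dt) (δ := D * dt)
    (R := R + r) (A := A)
    (fun x => ?_) (fun x hx => ?_) (fun x => ?_) (fun x hx => ?_) (hAk k hk.le) (hAk (k + 1) hk)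
  · refine hmain.trans ?_
    calc _ ≤ ((1 + 3 ^ d) * (Ci * B * dt) + D * dt) * √(volume.real (cube d (R + r))) * A := by
          gcongr
      _ = _ := by ring
  · rw [abs_sub_comm]
    have := hCi φ B N dx (hφ _) hB hdx (fun x hx => hsupp x fun h => hx (hcube (hL ▸ hRL) h)) x
    exact this.trans (mul_le_mul_of_nonneg_left hdxt (by positivity))
  · have h1 : x ∉ cube d R := fun h => hx (hcube (by linarith) h)
    have h2 : x ∉ cube d (R + (p + 1) * dx) := fun h => hx (hcube ?_ h)
    · rw [hsupp x h1, zero_sub, neg_eq_zero]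
      exact interpolant_eq_zero hdx hsupp h2
    · have : (p + 1) * dx ≤ p + 1 := mul_le_of_le_one_right (by positivity) hdx1
      have h3 : 0 ≤ M + |σ| * ν := by positivity
      linarith
  · exact abs_sum_weight_mul_sub_le ((hφ 1).differentiable (by simp)) hK₁ hK₂ hdt0.le hν x _
      fun l => hyx l x
  · refine sum_weight_mul_sub_eq_zero (r := r) hr0 hsupp _ (fun l => (hyx' l x).trans ?_) hx
    rw [hr]
    linarith [(by positivity : (0 : ℝ) ≤ p + 1)]

end Uniform

end

end LagrangeGalerkin

/-! ### Relative compactness of the family -/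

open LagrangeGalerkin in
theorem lemma3p2 {d : ℕ} (hd : 0 < d) (T σ : ℝ) (hT : 0 < T) (hσ : σ ≠ 0)
    (b : ℝ → LagrangeGalerkin.Space d → LagrangeGalerkin.Space d)
    (hb : LagrangeGalerkin.AdmissibleDrift T b)
    (m₀ : LagrangeGalerkin.Space d → ℝ) (hm₀ : LagrangeGalerkin.InitialDensity m₀)
    (p : ℕ) (L : ℕ → ℝ) (hL : LagrangeGalerkin.AdmissibleHalfWidth T σ b m₀ L) :
    ∃ dt₀ : ℝ, 0 < dt₀ ∧ IsCompact (closure (LagrangeGalerkin.family T σ b m₀ p L dt₀)) := by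
  obtain ⟨M, hM⟩ := hb.bounded
  obtain ⟨C, hC, hlip⟩ := hb.lipschitz
  obtain ⟨C₀, r, hr, -, hold⟩ := hm₀.holder
  have hcont : Continuous m₀ := hold.continuous hr
  have hcs := hm₀.compact_support
  -- The bound `1` controls `Δx` and the step lengths; `1 / C` makes the implicit step solvable and
  -- antilipschitz.
  refine ⟨min 1 (1 / C), by positivity, ?_⟩
  have hdt : ∀ {n : ℕ}, T / n ≤ min 1 (1 / C) → T / n ≤ 1 ∧ C * (T / n) ≤ 1 := fun h => by
    refine ⟨h.trans (min_le_left _ _), ?_⟩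
    have := mul_le_mul_of_nonneg_left (h.trans (min_le_right _ _)) hC.le
    rwa [mul_one_div_cancel hC.ne'] at this
  have hdx : ∀ {n N : ℕ}, 0 < N → 0 < L n / N ∧ N * (L n / N) = L n := fun {n N} hN => by
    have hN' : (0 : ℝ) < N := by exact_mod_cast hN
    exact ⟨div_pos (hL.pos n) hN', by field_simp⟩
  set A := Real.exp (2 * C * T * d) * l2norm m₀
  have hpair : ∀ (φ : 𝓓((⊤ : TopologicalSpace.Opens (Space d)), ℝ)) {n N : ℕ}, 0 < n → 0 < N →
      C * (T / n) ≤ 1 → ∀ k ≤ n,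
      |∫ x, φ x * gridDensity b σ (T / n) m₀ p N (L n) (L n / N) k x| ≤ A * l2norm φ := by
    intro φ n N hn hN hCdt k hk
    obtain ⟨h0, h1⟩ := hdx (n := n) hN
    refine (abs_integral_mul_le (memLp_two_of_continuous φ.continuous φ.hasCompactSupport)
      (memLp_gridDensity h0 h1 ..)).trans ?_
    rw [mul_comm]
    exact mul_le_mul_of_nonneg_right
      (l2norm_gridDensity_le hT hC hlip hcont hcs hn hCdt h0 h1 hk) (l2norm_nonneg _)
  refine isCompact_closure_of_bounded_of_lipschitz (C := A) _ ?_ fun φ => ?_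
  · rintro f ⟨n, N, hn, hN, hn0, -, rfl⟩ t φ
    rw [curve_apply]
    exact abs_sum_hat_mul_le (hpair φ hn hN (hdt hn0).2)
  · obtain ⟨κ, R, hκ, hinc⟩ := exists_abs_increment_le (p := p) (σ := σ) hT hC hlip hM hcont hcs φ
      (fun n => φ.contDiff.of_le (by exact_mod_cast le_top)) φ.hasCompactSupport
    obtain ⟨n₀, hn₀⟩ := Filter.eventually_atTop.1
      ((tendsto_halfWidth hd hT hσ hb hm₀ hL).eventually_ge_atTop R)
    have hAφ : 0 ≤ A * l2norm φ :=
      mul_nonneg (mul_nonneg (Real.exp_pos _).le (l2norm_nonneg _)) (l2norm_nonneg _)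
    -- For `n ≥ n₀` the domain contains the support of `φ` and `κ` suffices. For `n < n₀` the
    -- increment is at most twice the uniform bound `A * l2norm φ`, and `1 ≤ (n₀ / T) * (T / n)`
    -- supplies the missing factor `Δt`, uniformly in `N`.
    refine ⟨κ + 2 * (A * l2norm φ) * (n₀ / T), ?_⟩
    rintro f ⟨n, N, hn, hN, hn0, hdxt, rfl⟩ s t
    have hn' : (0 : ℝ) < n := by exact_mod_cast hn
    have hdt0 : 0 < T / n := by positivity
    have hmem : ∀ u : Set.Icc (0 : ℝ) T, (u : ℝ) / (T / n) ∈ Set.Icc (0 : ℝ) n := fun u => by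
      refine ⟨div_nonneg u.2.1 hdt0.le, ?_⟩
      rw [div_le_iff₀ hdt0, mul_div_cancel₀ _ hn'.ne']
      exact u.2.2
    rw [curve_apply, curve_apply]
    refine (abs_sum_hat_mul_sub_le (δ := (κ + 2 * (A * l2norm φ) * (n₀ / T)) * (T / n))
      (fun k hk => ?_) (hmem s) (hmem t)).trans (le_of_eq ?_)
    · rcases le_or_gt n₀ n with h | h
      · refine (hinc n N (L n) (L n / N) hn (hdt hn0).1 (hdt hn0).2 (hdx hN).1 (hdx hN).2 hdxt
          (hn₀ n h) k hk).trans ?_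
        gcongr
        have : 0 ≤ 2 * (A * l2norm φ) * (n₀ / T) := by positivity
        linarith
      · have h1 := hpair φ hn hN (hdt hn0).2 k hk.le
        have h2 := hpair φ hn hN (hdt hn0).2 (k + 1) hk
        have h3 : (1 : ℝ) ≤ n₀ / T * (T / n) := by
          have : (n : ℝ) ≤ n₀ := by exact_mod_cast h.le
          rw [div_mul_div_cancel₀ hT.ne', le_div_iff₀ hn']
          linarith
        have h4 := mul_le_mul_of_nonneg_left h3 (by positivity : 0 ≤ 2 * (A * l2norm φ))
        have h5 : 0 ≤ κ * (T / n) := by positivity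
        refine (abs_sub _ _).trans ?_
        rw [add_mul, mul_assoc (2 * (A * l2norm φ))]
        linarith
    · rw [Subtype.dist_eq, Real.dist_eq, ← sub_div, abs_div, abs_of_pos hdt0]
      field_simp
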